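/- Let $P$ be a plain (non-symmetric) operad in sets: sets $P_n$ ($n\ge 0$), an identity $1\in P_1$ and associative, unital compositions $p\circ(q_1,\dots,q_n)$. For $n \ge 0$ let $\mathrm{Wk}(P)_n$ be the category whose objects are the $n$-leaved planar rooted trees with each $m$-ary node labelled by an element of $P_m$ (the trivial tree $|$ included), with exactly one morphism $s\to t$ if $\varepsilon(s)=\varepsilon(t)$ and none otherwise, where $\varepsilon(s)\in P_n$ is obtained by composing the labels of $s$ in $P$. With grafting of trees as composition and $|$ as identity, $\mathrm{Wk}(P)$ is an operad enriched in $\mathbf{Cat}$. A weak $P$-category is a (strict) algebra in $\mathbf{Cat}$ for $\mathrm{Wk}(P)$: a category $A$ with functors $h_n:\mathrm{Wk}(P)_n\times A^n\to A$, written $h$, strictly compatible with composition and identity. A strict $P$-category is such an algebra for $D_*P$, where $(D_*P)_n$ is the discrete category on $P_n$; it is regarded as a weak $P$-category via $\varepsilon:\mathrm{Wk}(P)\to D_*P$. Let $\textbf{Wk-}P\textbf{-Cat}$ be the $2$-category of weak $P$-categories, weak $P$-functors (functors $F$ with natural isomorphisms $h'(q,Fa_\bullet)\cong F h(q,a_\bullet)$,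 natural also in $q$, compatible with operadic composition and identity) and $P$-transformations (natural transformations commuting with these isomorphisms). Let $(A,h)$ be a weak $P$-category. Put $P\circ A=\coprod_n D_*P_n\times A^n$ and let $h(\iota\circ 1):P\circ A\to A$ be the functor $(p,a_1,\dots,a_n)\mapsto h(\iota(p),a_1,\dots,a_n)$, where $\iota(p)$ is the tree with one node, labelled $p$. Let $\mathbf{st}\,A$ be the category whose objects are those of $P\circ A$, a morphism $(p,a_\bullet)\to(p',a'_\bullet)$ being a morphism $h(\iota(p),a_\bullet)\to h(\iota(p'),a'_\bullet)$ of $A$, with identities and composition as in $A$. Let $P$ act on $\mathbf{st}\,A$ on objects by $$\bigl(p,(p_1,a^1_\bullet),\dots,(p_n,a^n_\bullet)\bigr)\mapsto\bigl(p\circ(p_1,\dots,p_n),\,a^1_\bullet,\dots,a^n_\bullet\bigr),$$ and on morphisms $f_i:(p_i,a^i_\bullet)\to(p_i',b^i_\bullet)$ by sending $(p,f_1,\dots,f_n)$ to $\delta\circ h(\iota(p),f_1,\dots,f_n)\circ\delta^{-1}$, where each $\delta$ is the isomorphism $$h\bigl(\iota(p),h(\iota(p_1),a^1_\bullet),\dots,h(\iota(p_n),a^n_\bullet)\bigr)\cong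 h\bigl(\iota(p\circ(p_1,\dots,p_n)),a^1_\bullet,\dots,a^n_\bullet\bigr)$$ (respectively its analogue with $p_i',b^i_\bullet$) which is the image under $h$ of the unique morphism of $\mathrm{Wk}(P)$ from the grafting of $\iota(p_1),\dots,\iota(p_n)$ on $\iota(p)$ to $\iota(p\circ(p_1,\dots,p_n))$. Then the evident functors $P\circ A\to\mathbf{st}\,A\to A$ factor $h(\iota\circ 1)$ as a bijective-on-objects functor followed by a full and faithful one; the above action makes $\mathbf{st}\,A$ a strict $P$-category; and $A$ is equivalent to $\mathbf{st}\,A$ in the $2$-category $\textbf{Wk-}P\textbf{-Cat}$. -/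

import Mathlib

open CategoryTheory
open scoped CategoryTheory.Prod

universe w v' v u

set_option linter.checkUnivs false

/-! ### Splitting and joining finite sequences -/

/-- The sum of a double sequence, computed block by block. -/
theorem sum_blocks {n : ℕ} (k : Fin n → ℕ) (l : Fin (∑ i, k i) → ℕ) :
    ∑ i, ∑ j, l (finSigmaFinEquiv ⟨i, j⟩) = ∑ x, l x := by
  rw [← Equiv.sum_comp (finSigmaFinEquiv (n := k)) l, Fintype.sum_sigma]

theorem sum_ones (n : ℕ) : ∑ _ : Fin n, 1 = n := by simp

theorem finSigmaFinEquiv_val {n : ℕ} (k : Fin n → ℕ) (i : Fin n) (j : Fin (k i)) :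
    ((finSigmaFinEquiv ⟨i, j⟩ : Fin (∑ i, k i)) : ℕ) =
      (∑ y, if y < i then k y else 0) + j := by
  rw [finSigmaFinEquiv_apply]
  congr 1
  rw [← Finset.sum_filter]
  refine Finset.sum_bij (fun a _ => Fin.castLE i.2.le a) ?_ ?_ ?_ ?_
  · intro a _
    simp only [Finset.mem_filter, Finset.mem_univ, true_and, Fin.lt_def]
    exact a.2
  · intro a _ b _ h
    simpa [Fin.ext_iff] using h
  · intro b hb
    simp only [Finset.mem_filter, Finset.mem_univ, true_and] at hb
    exact ⟨⟨b, hb⟩, Finset.mem_univ _, rfl⟩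
  · intro a _
    rfl

theorem finSigmaFinEquiv_lt {n : ℕ} (k : Fin n → ℕ) (i i' : Fin n) (j : Fin (k i))
    (j' : Fin (k i')) :
    (finSigmaFinEquiv ⟨i', j'⟩ : Fin (∑ i, k i)) < finSigmaFinEquiv ⟨i, j⟩ ↔
      i' < i ∨ (i' = i ∧ (j' : ℕ) < j) := by
  have key : ∀ (a b : Fin n) (c : Fin (k a)) (d : Fin (k b)), a < b →
      (finSigmaFinEquiv ⟨a, c⟩ : Fin (∑ i, k i)) < finSigmaFinEquiv ⟨b, d⟩ := by
    intro a b c d hab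
    rw [Fin.lt_def, finSigmaFinEquiv_val, finSigmaFinEquiv_val]
    have h1 : (∑ y, if y < a then k y else 0) + k a ≤ ∑ y, if y < b then k y else 0 := by
      have : k a = ∑ y, if y = a then k y else 0 := by simp
      rw [this, ← Finset.sum_add_distrib]
      refine Finset.sum_le_sum fun y _ => ?_
      rcases lt_trichotomy y a with h | h | h
      · simp [h, h.ne, h.trans hab]
      · subst h
        simp [hab]
      · simp [h.not_gt, h.ne']
    have := c.2
    omega
  rcases lt_trichotomy i' i with h | h | h
  · simp [h, key _ _ j' j h]
  · subst h
    rw [Fin.lt_def, finSigmaFinEquiv_val, finSigmaFinEquiv_val]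
    simp
  · simp [h.not_gt, h.ne', (key _ _ j j' h).le]

/-- The two ways of numbering the entries of a triple sequence agree. -/
theorem finSigmaFinEquiv_assoc {n : ℕ} (k : Fin n → ℕ) (l : Fin (∑ i, k i) → ℕ) (i : Fin n)
    (j : Fin (k i)) (m : Fin (l (finSigmaFinEquiv ⟨i, j⟩))) :
    Fin.cast (sum_blocks k l)
        (finSigmaFinEquiv ⟨i, finSigmaFinEquiv ⟨j, m⟩⟩ :
          Fin (∑ i, ∑ j, l (finSigmaFinEquiv ⟨i, j⟩))) =
      finSigmaFinEquiv ⟨finSigmaFinEquiv ⟨i, j⟩, m⟩ := by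
  apply Fin.ext
  rw [Fin.val_cast, finSigmaFinEquiv_val, finSigmaFinEquiv_val, finSigmaFinEquiv_val,
    ← Equiv.sum_comp (finSigmaFinEquiv (n := k)), Fintype.sum_sigma, ← add_assoc]
  congr 1
  have hi : ∀ i' : Fin n, (∑ j', if (finSigmaFinEquiv ⟨i', j'⟩ : Fin (∑ i, k i)) <
      finSigmaFinEquiv ⟨i, j⟩ then l (finSigmaFinEquiv ⟨i', j'⟩) else 0) =
      (if i' < i then ∑ j', l (finSigmaFinEquiv ⟨i', j'⟩) else 0) +
      (if i' = i then ∑ j', (if j' < j then l (finSigmaFinEquiv ⟨i, j'⟩) else 0) else 0) := by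
    intro i'
    simp only [finSigmaFinEquiv_lt]
    rcases lt_trichotomy i' i with h | h | h
    · simp [h, h.ne]
    · subst h
      simp
    · simp [h.not_gt, h.ne']
  rw [Finset.sum_congr rfl fun i' _ => hi i', Finset.sum_add_distrib]
  simp

/-- The `i`-th block of a sequence of length `∑ i, k i`. -/
abbrev block {X : Type*} {n : ℕ} {k : Fin n → ℕ} (a : Fin (∑ i, k i) → X) (i : Fin n) :
    Fin (k i) → X :=
  fun j => a (finSigmaFinEquiv ⟨i, j⟩)

/-- The concatenation of a sequence of sequences. -/
def concat {X : Type*} {n : ℕ} {k : Fin n → ℕ} (a : ∀ i, Fin (k i) → X) :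
    Fin (∑ i, k i) → X :=
  fun x => a (finSigmaFinEquiv.symm x).1 (finSigmaFinEquiv.symm x).2

@[simp]
theorem block_concat {X : Type*} {n : ℕ} {k : Fin n → ℕ} (a : ∀ i, Fin (k i) → X) (i : Fin n) :
    block (concat a) i = a i := by
  funext j
  simp only [block, concat]
  rw [Equiv.symm_apply_apply]

theorem heq_apply {X : Type*} {Y : X → Type*} (f : ∀ x, Y x) {x x' : X} (h : x = x') :
    HEq (f x) (f x') := by
  subst h
  rfl

/-- Transport of an operation along an equality of arities. -/
def castArity {X : ℕ → Type w} {m n : ℕ} (h : m = n) (x : X m) : X n := h ▸ x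

theorem castArity_heq {X : ℕ → Type w} {m n : ℕ} (h : m = n) (x : X m) :
    HEq (castArity h x) x := by
  subst h
  rfl

/-! ### Plain operads -/

/-- A plain (non-symmetric) operad in sets.  In the axioms the two sides have arities which are
equal, but not syntactically so; hence the heterogeneous equalities. -/
structure PlainOperad where
  /-- the set of `n`-ary operations -/
  Op : ℕ → Type w
  /-- the identity operation -/
  one : Op 1
  /-- operadic composition `p ∘ (q₁, …, qₙ)` -/
  comp {n : ℕ} {k : Fin n → ℕ} (p : Op n) (q : ∀ i, Op (k i)) : Op (∑ i, k i)
  assoc {n : ℕ} {k : Fin n → ℕ} {l : Fin (∑ i, k i) → ℕ} (p : Op n) (q : ∀ i, Op (k i))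
    (r : ∀ x, Op (l x)) :
    HEq (comp (comp p q) r) (comp p fun i => comp (q i) fun j => r (finSigmaFinEquiv ⟨i, j⟩))
  one_comp {k : Fin 1 → ℕ} (q : ∀ i, Op (k i)) : HEq (comp one q) (q 0)
  comp_one {n : ℕ} (p : Op n) : HEq (comp p fun _ => one) p

/-! ### Trees and the free operad -/

/-- Strongly regular `n`-ary trees labelled by a signature `Φ`. -/
inductive SRTree (Φ : ℕ → Type w) : ℕ → Type w
  /-- the trivial tree `|` -/
  | leaf : SRTree Φ 1
  /-- the tree `φ ∘ (t₁, …, tₙ)` -/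
  | node {n : ℕ} (φ : Φ n) {k : Fin n → ℕ} (t : ∀ i, SRTree Φ (k i)) : SRTree Φ (∑ i, k i)

namespace SRTree

variable {Φ : ℕ → Type w}

/-- Grafting of trees. -/
def graft : {n : ℕ} → SRTree Φ n → {k : Fin n → ℕ} → (∀ i, SRTree Φ (k i)) →
    SRTree Φ (∑ i, k i)
  | _, .leaf, _, s => castArity (Fin.sum_univ_one _).symm (s 0)
  | _, .node φ t, l, s => castArity (sum_blocks _ l)
      (.node φ fun i => (t i).graft fun j => s (finSigmaFinEquiv ⟨i, j⟩))

theorem node_congr {n : ℕ} (φ : Φ n) {k k' : Fin n → ℕ} (hk : ∀ i, k i = k' i)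
    {t : ∀ i, SRTree Φ (k i)} {t' : ∀ i, SRTree Φ (k' i)} (ht : ∀ i, HEq (t i) (t' i)) :
    HEq (node φ t) (node φ t') := by
  obtain rfl : k = k' := funext hk
  obtain rfl : t = t' := funext fun i => eq_of_heq (ht i)
  rfl

theorem graft_congr {n : ℕ} (t : SRTree Φ n) {k k' : Fin n → ℕ} (hk : ∀ i, k i = k' i)
    {s : ∀ i, SRTree Φ (k i)} {s' : ∀ i, SRTree Φ (k' i)} (hs : ∀ i, HEq (s i) (s' i)) :
    HEq (t.graft s) (t.graft s') := by
  obtain rfl : k = k' := funext hk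
  obtain rfl : s = s' := funext fun i => eq_of_heq (hs i)
  rfl

theorem castArity_graft {m n : ℕ} (h : m = n) (t : SRTree Φ m) {k : Fin n → ℕ}
    (s : ∀ i, SRTree Φ (k i)) :
    HEq ((castArity h t).graft s) (t.graft fun i => s (Fin.cast h i)) := by
  subst h
  rfl

theorem leaf_graft {k : Fin 1 → ℕ} (s : ∀ i, SRTree Φ (k i)) :
    HEq ((leaf : SRTree Φ 1).graft s) (s 0) :=
  castArity_heq _ _

theorem graft_leaf {n : ℕ} (t : SRTree Φ n) : HEq (t.graft fun _ => leaf) t := by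
  induction t with
  | leaf => exact leaf_graft _
  | node φ t ih =>
    refine (castArity_heq _ _).trans (node_congr φ (fun i => ?_) ih)
    simp

theorem graft_assoc {n : ℕ} (t : SRTree Φ n) {k : Fin n → ℕ} {l : Fin (∑ i, k i) → ℕ}
    (s : ∀ i, SRTree Φ (k i)) (r : ∀ x, SRTree Φ (l x)) :
    HEq ((t.graft s).graft r)
      (t.graft fun i => (s i).graft fun j => r (finSigmaFinEquiv ⟨i, j⟩)) := by
  induction t with
  | leaf =>
    refine (castArity_graft _ _ _).trans (HEq.trans ?_ (leaf_graft _).symm)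
    have h : ∀ j : Fin (k 0), Fin.cast (Fin.sum_univ_one k).symm j = finSigmaFinEquiv ⟨0, j⟩ := by
      intro j
      apply Fin.ext
      rw [finSigmaFinEquiv_val]
      simp
    refine graft_congr _ (fun j => by rw [h]) (fun j => by rw [h])
  | node φ t ih =>
    refine (castArity_graft _ _ _).trans ((castArity_heq _ _).trans
      (HEq.trans ?_ (castArity_heq _ _).symm))
    refine node_congr φ (fun i => ?_) (fun i => ?_)
    · rw [← sum_blocks]
      exact Finset.sum_congr rfl fun j _ => Finset.sum_congr rfl fun m _ =>
        congrArg l (finSigmaFinEquiv_assoc _ _ _ _ _)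
    · refine (ih i _ _).trans (graft_congr _ (fun j => ?_) fun j => ?_)
      · exact Finset.sum_congr rfl fun m _ => congrArg l (finSigmaFinEquiv_assoc _ _ _ _ _)
      · exact graft_congr _ (fun m => congrArg l (finSigmaFinEquiv_assoc _ _ _ _ _))
          (fun m => heq_apply r (finSigmaFinEquiv_assoc _ _ _ _ _))

/-- The free plain operad on a signature. -/
def freeOperad (Φ : ℕ → Type w) : PlainOperad.{w} where
  Op := SRTree Φ
  one := leaf
  comp t s := t.graft s
  assoc t s r := graft_assoc t s r
  one_comp s := leaf_graft s
  comp_one t := graft_leaf t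

end SRTree

namespace PlainOperad

variable (P : PlainOperad.{w})

theorem comp_congr {n : ℕ} (p : P.Op n) {k k' : Fin n → ℕ} (hk : ∀ i, k i = k' i)
    {q : ∀ i, P.Op (k i)} {q' : ∀ i, P.Op (k' i)} (hq : ∀ i, HEq (q i) (q' i)) :
    HEq (P.comp p q) (P.comp p q') := by
  obtain rfl : k = k' := funext hk
  obtain rfl : q = q' := funext fun i => eq_of_heq (hq i)
  rfl

variable {P}

/-- The counit `ε` of the free operad adjunction: evaluation of a tree labelled by the operations
of `P`. -/
def eval : {n : ℕ} → SRTree P.Op n → P.Op n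
  | _, .leaf => P.one
  | _, .node p t => P.comp p fun i => eval (t i)

theorem eval_castArity {m n : ℕ} (h : m = n) (t : SRTree P.Op m) :
    HEq (eval (castArity h t)) (eval t) := by
  subst h
  rfl

theorem eval_graft {n : ℕ} (t : SRTree P.Op n) {k : Fin n → ℕ} (s : ∀ i, SRTree P.Op (k i)) :
    eval (t.graft s) = P.comp (eval t) fun i => eval (s i) := by
  induction t with
  | leaf =>
    apply eq_of_heq
    exact (eval_castArity _ _).trans (P.one_comp fun i => eval (s i)).symm
  | node p t ih =>
    apply eq_of_heq
    refine (eval_castArity _ _).trans (HEq.trans ?_ (P.assoc _ _ _).symm)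
    exact P.comp_congr p (fun _ => rfl) fun i => heq_of_eq (ih i _)

/-- The corolla `p ∘ (|, …, |)`. -/
def corolla {n : ℕ} (p : P.Op n) : SRTree P.Op n :=
  castArity (sum_ones n) (.node p fun _ : Fin n => .leaf)

theorem eval_corolla {n : ℕ} (p : P.Op n) : eval (corolla p) = p :=
  eq_of_heq ((eval_castArity _ _).trans (P.comp_one p))

end PlainOperad

/-! ### Plain `Cat`-operads, their algebras and the maps between these -/

/-- A plain operad enriched in `Cat`: a sequence of categories with composition functors, subject
to the operad axioms, strictly, both for 1-cells (objects) and for 2-cells (morphisms). -/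
structure CatOperad where
  /-- the category of `n`-ary operations -/
  Op : ℕ → Type w
  [cat : ∀ n, Category.{v'} (Op n)]
  /-- the identity operation -/
  one : Op 1
  /-- the composition functor `Qₙ × Q_{k₁} × ⋯ × Q_{kₙ} ⥤ Q_{k₁ + ⋯ + kₙ}` -/
  comp {n : ℕ} (k : Fin n → ℕ) : Op n × (∀ i, Op (k i)) ⥤ Op (∑ i, k i)
  assoc_obj {n : ℕ} {k : Fin n → ℕ} {l : Fin (∑ i, k i) → ℕ} (p : Op n) (q : ∀ i, Op (k i))
    (r : ∀ x, Op (l x)) :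
    HEq ((comp l).obj ((comp k).obj (p, q), r))
      ((comp _).obj (p, fun i => (comp _).obj (q i, fun j => r (finSigmaFinEquiv ⟨i, j⟩))))
  assoc_map {n : ℕ} {k : Fin n → ℕ} {l : Fin (∑ i, k i) → ℕ} {p p' : Op n}
    {q q' : ∀ i, Op (k i)} {r r' : ∀ x, Op (l x)} (f : p ⟶ p') (g : ∀ i, q i ⟶ q' i)
    (t : ∀ x, r x ⟶ r' x) :
    HEq ((comp l).map (Prod.mkHom (Y₁ := r) (Y₂ := r')
        ((comp k).map (Prod.mkHom (Y₁ := q) (Y₂ := q') f g)) t))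
      ((comp _).map (Prod.mkHom
        (Y₁ := fun i => (comp _).obj (q i, fun j => r (finSigmaFinEquiv ⟨i, j⟩)))
        (Y₂ := fun i => (comp _).obj (q' i, fun j => r' (finSigmaFinEquiv ⟨i, j⟩))) f
        fun i => (comp _).map (Prod.mkHom (Y₁ := fun j => r (finSigmaFinEquiv ⟨i, j⟩))
          (Y₂ := fun j => r' (finSigmaFinEquiv ⟨i, j⟩)) (g i)
            fun j => t (finSigmaFinEquiv ⟨i, j⟩))))
  one_comp_obj {k : Fin 1 → ℕ} (q : ∀ i, Op (k i)) : HEq ((comp k).obj (one, q)) (q 0)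
  one_comp_map {k : Fin 1 → ℕ} {q q' : ∀ i, Op (k i)} (g : ∀ i, q i ⟶ q' i) :
    HEq ((comp k).map (Prod.mkHom (Y₁ := q) (Y₂ := q') (𝟙 one) g)) (g 0)
  comp_one_obj {n : ℕ} (p : Op n) : HEq ((comp _).obj (p, fun _ => one)) p
  comp_one_map {n : ℕ} {p p' : Op n} (f : p ⟶ p') :
    HEq ((comp _).map (Prod.mkHom (Y₁ := fun _ => one) (Y₂ := fun _ => one) f fun _ => 𝟙 one)) f

attribute [instance] CatOperad.cat

namespace CatOperad

/-- The data of an action of a `Cat`-operad on a category: functors `hₙ : Qₙ × Aⁿ ⥤ A`. -/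
structure Action (Q : CatOperad.{w, v'}) (A : Type u) [Category.{v} A] where
  act (n : ℕ) : Q.Op n × (Fin n → A) ⥤ A

/-- The axioms `h(1, -) = id` and `h(p ∘ q_•, -) = h(p, h(q₁, -), …, h(qₙ, -))` of an algebra,
as strict equalities of functors. -/
structure Action.IsAlgebra {Q : CatOperad.{w, v'}} {A : Type u} [Category.{v} A]
    (h : Q.Action A) : Prop where
  one_obj (a : Fin 1 → A) : (h.act 1).obj (Q.one, a) = a 0
  one_map {a b : Fin 1 → A} (t : ∀ i, a i ⟶ b i) :
    (h.act 1).map (Prod.mkHom (Y₁ := a) (Y₂ := b) (𝟙 Q.one) t) =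
      eqToHom (one_obj a) ≫ t 0 ≫ eqToHom (one_obj b).symm
  comp_obj {n : ℕ} {k : Fin n → ℕ} (p : Q.Op n) (q : ∀ i, Q.Op (k i))
    (a : Fin (∑ i, k i) → A) :
    (h.act _).obj ((Q.comp k).obj (p, q), a) =
      (h.act n).obj (p, fun i => (h.act (k i)).obj (q i, block a i))
  comp_map {n : ℕ} {k : Fin n → ℕ} {p p' : Q.Op n} {q q' : ∀ i, Q.Op (k i)}
    {a b : Fin (∑ i, k i) → A} (f : p ⟶ p') (g : ∀ i, q i ⟶ q' i) (t : ∀ x, a x ⟶ b x) :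
    (h.act _).map (Prod.mkHom (Y₁ := a) (Y₂ := b)
        ((Q.comp k).map (Prod.mkHom (Y₁ := q) (Y₂ := q') f g)) t) =
      eqToHom (comp_obj p q a) ≫
        (h.act n).map (Prod.mkHom
          (Y₁ := fun i => (h.act (k i)).obj (q i, block a i))
          (Y₂ := fun i => (h.act (k i)).obj (q' i, block b i)) f
          fun i => (h.act (k i)).map (Prod.mkHom (Y₁ := block a i) (Y₂ := block b i) (g i)
            fun j => t (finSigmaFinEquiv ⟨i, j⟩))) ≫
        eqToHom (comp_obj p' q' b).symm

/-- An algebra in `Cat` for a plain `Cat`-operad `Q`. -/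
structure Algebra (Q : CatOperad.{w, v'}) where
  carrier : Type u
  [category : Category.{v} carrier]
  action : Q.Action carrier
  isAlgebra : action.IsAlgebra

attribute [instance] Algebra.category

variable {Q : CatOperad.{w, v'}}

/-- The functor `hₙ : Qₙ × Aⁿ ⥤ A` of an algebra. -/
abbrev Algebra.act (A : Algebra.{w, v', v, u} Q) (n : ℕ) :
    Q.Op n × (Fin n → A.carrier) ⥤ A.carrier :=
  A.action.act n

/-- The category `Q ∘ A = ∐ₙ Qₙ × Aⁿ`, for a sequence of categories `Q`. -/
abbrev Kel (Q : ℕ → Type w) [∀ n, Category.{v'} (Q n)] (A : Type u) [Category.{v} A] :=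
  Σ n, Q n × (Fin n → A)

/-- The structure map `h : Q ∘ A ⥤ A`. -/
def Algebra.structureMap (A : Algebra.{w, v', v, u} Q) : Kel Q.Op A.carrier ⥤ A.carrier :=
  Sigma.desc A.act

/-- A weak map of `Q`-algebras: a functor `F` with natural isomorphisms
`coh : h'(q, F a_•) ≅ F h(q, a_•)`, compatible with the identity and with operadic composition. -/
structure WeakMap (A B : Algebra.{w, v', v, u} Q) where
  functor : A.carrier ⥤ B.carrier
  coh {n : ℕ} (q : Q.Op n) (a : Fin n → A.carrier) :
    (B.act n).obj (q, fun i => functor.obj (a i)) ≅ functor.obj ((A.act n).obj (q, a))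
  coh_naturality {n : ℕ} {q q' : Q.Op n} {a b : Fin n → A.carrier} (f : q ⟶ q')
    (t : ∀ i, a i ⟶ b i) :
    (B.act n).map (Prod.mkHom (Y₁ := fun i => functor.obj (a i))
        (Y₂ := fun i => functor.obj (b i)) f fun i => functor.map (t i)) ≫ (coh q' b).hom =
      (coh q a).hom ≫ functor.map ((A.act n).map (Prod.mkHom (Y₁ := a) (Y₂ := b) f t))
  coh_one (a : Fin 1 → A.carrier) :
    (coh Q.one a).hom =
      eqToHom ((B.isAlgebra.one_obj _).trans (congrArg functor.obj (A.isAlgebra.one_obj a).symm))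
  coh_comp {n : ℕ} {k : Fin n → ℕ} (p : Q.Op n) (q : ∀ i, Q.Op (k i))
    (a : Fin (∑ i, k i) → A.carrier) :
    (coh ((Q.comp k).obj (p, q)) a).hom =
      eqToHom (B.isAlgebra.comp_obj p q _) ≫
        (B.act n).map (Prod.mkHom
          (Y₁ := fun i => (B.act (k i)).obj (q i, fun j => functor.obj (block a i j)))
          (Y₂ := fun i => functor.obj ((A.act (k i)).obj (q i, block a i))) (𝟙 p)
          fun i => (coh (q i) (block a i)).hom) ≫
        (coh p fun i => (A.act (k i)).obj (q i, block a i)).hom ≫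
        functor.map (eqToHom (A.isAlgebra.comp_obj p q a).symm)

/-- A `Q`-transformation between weak maps of `Q`-algebras. -/
@[ext]
structure Transformation {A B : Algebra.{w, v', v, u} Q} (F G : WeakMap A B) where
  natTrans : F.functor ⟶ G.functor
  comm {n : ℕ} (q : Q.Op n) (a : Fin n → A.carrier) :
    (B.act n).map (Prod.mkHom (Y₁ := fun i => F.functor.obj (a i))
        (Y₂ := fun i => G.functor.obj (a i)) (𝟙 q) fun i => natTrans.app (a i)) ≫
        (G.coh q a).hom =
      (F.coh q a).hom ≫ natTrans.app ((A.act n).obj (q, a))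

/-- Composition and identities of `Q`-transformations are those of natural transformations. -/
instance {A B : Algebra.{w, v', v, u} Q} : Category (WeakMap A B) where
  Hom F G := Transformation F G
  id F :=
    { natTrans := 𝟙 _
      comm := fun {n} q a => by
        have : (Prod.mkHom (Y₁ := fun i => F.functor.obj (a i))
            (Y₂ := fun i => F.functor.obj (a i)) (𝟙 q)
            fun i => (𝟙 F.functor : F.functor ⟶ F.functor).app (a i)) = 𝟙 _ := rfl
        rw [this]
        simp }
  comp {F G H} σ τ :=
    { natTrans := σ.natTrans ≫ τ.natTrans
      comm := fun {n} q a => by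
        have : (Prod.mkHom (Y₁ := fun i => F.functor.obj (a i))
            (Y₂ := fun i => H.functor.obj (a i)) (𝟙 q)
            fun i => (σ.natTrans ≫ τ.natTrans).app (a i)) =
            (Prod.mkHom (Y₁ := fun i => F.functor.obj (a i))
              (Y₂ := fun i => G.functor.obj (a i)) (𝟙 q) fun i => σ.natTrans.app (a i)) ≫
            (Prod.mkHom (Y₁ := fun i => G.functor.obj (a i))
              (Y₂ := fun i => H.functor.obj (a i)) (𝟙 q) fun i => τ.natTrans.app (a i)) := by
          refine Prod.ext ?_ rfl
          exact (Category.id_comp _).symm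
        rw [this, Functor.map_comp, Category.assoc, τ.comm, reassoc_of% (σ.comm q a)]
        simp }
  id_comp _ := Transformation.ext (Category.id_comp _)
  comp_id _ := Transformation.ext (Category.comp_id _)
  assoc _ _ _ := Transformation.ext (Category.assoc _ _ _)

@[simp]
theorem id_natTrans {A B : Algebra.{w, v', v, u} Q} (F : WeakMap A B) :
    Transformation.natTrans (𝟙 F) = 𝟙 F.functor :=
  rfl

@[simp]
theorem comp_natTrans {A B : Algebra.{w, v', v, u} Q} {F G H : WeakMap A B} (σ : F ⟶ G) (τ : G ⟶ H) :
    Transformation.natTrans (σ ≫ τ) = σ.natTrans ≫ τ.natTrans :=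
  rfl

/-- The identity weak map. -/
def WeakMap.id (A : Algebra.{w, v', v, u} Q) : WeakMap A A where
  functor := 𝟭 _
  coh q a := Iso.refl _
  coh_naturality f t := by simp
  coh_one a := by simp
  coh_comp {n k} p q a := by
    have h := (A.act n).map_id (p, fun i => (A.act (k i)).obj (q i, block a i))
    refine Eq.trans ?_ (congrArg (fun x => eqToHom (A.isAlgebra.comp_obj p q a) ≫ x ≫ 𝟙 _ ≫
      eqToHom (A.isAlgebra.comp_obj p q a).symm) h.symm)
    simp

/-- Composition of weak maps: the coherence map of `F ⋙ G` is
`h''(q, G F a_•) ⟶ G h'(q, F a_•) ⟶ G F h(q, a_•)`. -/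
def WeakMap.comp {A B C : Algebra.{w, v', v, u} Q} (F : WeakMap A B) (G : WeakMap B C) : WeakMap A C where
  functor := F.functor ⋙ G.functor
  coh q a := G.coh q (fun i => F.functor.obj (a i)) ≪≫ G.functor.mapIso (F.coh q a)
  coh_naturality f t := by
    have h1 := F.coh_naturality f t
    have h2 := G.coh_naturality f (fun i => F.functor.map (t i))
    simp only [Functor.comp_map, Iso.trans_hom, Functor.mapIso_hom, Category.assoc,
      ← Functor.map_comp, ← h1]
    rw [Functor.map_comp, ← Category.assoc, ← Category.assoc, ← h2]
  coh_one a := by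
    simp [F.coh_one, G.coh_one, eqToHom_map]
  coh_comp {n k} p q a := by
    have h1 := F.coh_comp p q a
    have h2 := G.coh_comp p q (fun x => F.functor.obj (a x))
    have h3 := G.coh_naturality (𝟙 p) (fun i => (F.coh (q i) (block a i)).hom)
    have h4 := (C.act n).map_comp
      (Prod.mkHom (Y₁ := fun i => (C.act (k i)).obj
          (q i, fun j => G.functor.obj (F.functor.obj (block a i j))))
        (Y₂ := fun i => G.functor.obj ((B.act (k i)).obj
          (q i, fun j => F.functor.obj (block a i j)))) (𝟙 p)
        fun i => (G.coh (q i) fun j => F.functor.obj (block a i j)).hom)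
      (Prod.mkHom (Y₁ := fun i => G.functor.obj ((B.act (k i)).obj
          (q i, fun j => F.functor.obj (block a i j))))
        (Y₂ := fun i => G.functor.obj (F.functor.obj ((A.act (k i)).obj (q i, block a i)))) (𝟙 p)
        fun i => G.functor.map (F.coh (q i) (block a i)).hom)
    rw [prod_comp, Category.comp_id] at h4
    simp only [Iso.trans_hom, Functor.mapIso_hom, h1, h2, Functor.map_comp, eqToHom_map,
      Category.assoc]
    congr 1
    refine Eq.trans ?_ (congrArg (fun x => x ≫
      (G.coh p fun i => F.functor.obj ((A.act (k i)).obj (q i, block a i))).hom ≫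
        G.functor.map (F.coh p fun i => (A.act (k i)).obj (q i, block a i)).hom ≫
        eqToHom (congrArg (fun x => G.functor.obj (F.functor.obj x))
          (A.isAlgebra.comp_obj p q a).symm)) h4.symm)
    rw [Category.assoc, reassoc_of% h3]
    simp only [eqToHom_trans_assoc, eqToHom_refl, Category.id_comp]

/-- A natural transformation with identity components is compatible with equal coherence maps. -/
theorem comm_of_id {A B : Algebra.{w, v', v, u} Q} (F : A.carrier ⥤ B.carrier) {n : ℕ}
    (q : Q.Op n) (a : Fin n → A.carrier) {X : B.carrier}
    (f g : (B.act n).obj (q, fun i => F.obj (a i)) ⟶ X) (h : f = g) :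
    (B.act n).map (Prod.mkHom (Y₁ := fun i => F.obj (a i)) (Y₂ := fun i => F.obj (a i)) (𝟙 q)
      fun i => 𝟙 (F.obj (a i))) ≫ f = g ≫ 𝟙 X := by
  subst h
  rw [Category.comp_id]
  exact (congrArg (· ≫ f) ((B.act n).map_id (q, fun i => F.obj (a i)))).trans (Category.id_comp f)

/-- Constructor for 2-cells. -/
def homMk {A B : Algebra.{w, v', v, u} Q} {F G : WeakMap A B} (τ : F.functor ⟶ G.functor)
    (comm : ∀ {n : ℕ} (q : Q.Op n) (a : Fin n → A.carrier),
      (B.act n).map (Prod.mkHom (Y₁ := fun i => F.functor.obj (a i))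
          (Y₂ := fun i => G.functor.obj (a i)) (𝟙 q) fun i => τ.app (a i)) ≫ (G.coh q a).hom =
        (F.coh q a).hom ≫ τ.app ((A.act n).obj (q, a))) : F ⟶ G :=
  { natTrans := τ, comm := comm }

namespace WeakMap

variable {A B C D : Algebra.{w, v', v, u} Q}

/-- Left whiskering. -/
def whiskerLeft (F : WeakMap A B) {G H : WeakMap B C} (σ : G ⟶ H) : F.comp G ⟶ F.comp H :=
  homMk (Functor.whiskerLeft F.functor σ.natTrans) fun q a => by
    have h := σ.comm q (fun i => F.functor.obj (a i))
    have h' := σ.natTrans.naturality (F.coh q a).hom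
    simp only [WeakMap.comp, Iso.trans_hom, Functor.mapIso_hom, Functor.whiskerLeft_app,
      Category.assoc]
    rw [h', ← Category.assoc, ← Category.assoc, ← h]

/-- Right whiskering. -/
def whiskerRight {F G : WeakMap A B} (σ : F ⟶ G) (H : WeakMap B C) : F.comp H ⟶ G.comp H :=
  homMk (Functor.whiskerRight σ.natTrans H.functor) fun q a => by
    have h := σ.comm q a
    have h' := H.coh_naturality (𝟙 q) (fun i => σ.natTrans.app (a i))
    simp only [WeakMap.comp, Iso.trans_hom, Functor.mapIso_hom, Functor.whiskerRight_app,
      Category.assoc, ← Functor.map_comp, ← h]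
    rw [Functor.map_comp, ← Category.assoc, ← Category.assoc, ← h']

/-- Composition of weak maps is associative: the components of this 2-cell are identities. -/
def associator (F : WeakMap A B) (G : WeakMap B C) (H : WeakMap C D) :
    (F.comp G).comp H ≅ F.comp (G.comp H) where
  hom := homMk (Functor.associator F.functor G.functor H.functor).hom fun q a =>
    comm_of_id (F.functor ⋙ G.functor ⋙ H.functor) q a _ _ (by simp [WeakMap.comp])
  inv := homMk (Functor.associator F.functor G.functor H.functor).inv fun q a =>
    comm_of_id (F.functor ⋙ G.functor ⋙ H.functor) q a _ _ (by simp [WeakMap.comp])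
  hom_inv_id := Transformation.ext (Iso.hom_inv_id _)
  inv_hom_id := Transformation.ext (Iso.inv_hom_id _)

/-- The identity is a left unit: the components of this 2-cell are identities. -/
def leftUnitor (F : WeakMap A B) : (WeakMap.id A).comp F ≅ F where
  hom := homMk F.functor.leftUnitor.hom fun q a =>
    comm_of_id F.functor q a _ _ (by simp [WeakMap.comp, WeakMap.id])
  inv := homMk F.functor.leftUnitor.inv fun q a =>
    comm_of_id F.functor q a _ _ (by simp [WeakMap.comp, WeakMap.id])
  hom_inv_id := Transformation.ext (Iso.hom_inv_id _)
  inv_hom_id := Transformation.ext (Iso.inv_hom_id _)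

/-- The identity is a right unit: the components of this 2-cell are identities. -/
def rightUnitor (F : WeakMap A B) : F.comp (WeakMap.id B) ≅ F where
  hom := homMk F.functor.rightUnitor.hom fun q a =>
    comm_of_id F.functor q a _ _ (by simp [WeakMap.comp, WeakMap.id])
  inv := homMk F.functor.rightUnitor.inv fun q a =>
    comm_of_id F.functor q a _ _ (by simp [WeakMap.comp, WeakMap.id])
  hom_inv_id := Transformation.ext (Iso.hom_inv_id _)
  inv_hom_id := Transformation.ext (Iso.inv_hom_id _)

end WeakMap

instance : CategoryStruct (Algebra.{w, v', v, u} Q) where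
  Hom A B := WeakMap A B
  id A := WeakMap.id A
  comp F G := WeakMap.comp F G

/-- The 2-category of `Q`-algebras, weak maps and `Q`-transformations. -/
instance : Bicategory (Algebra.{w, v', v, u} Q) where
  homCategory A B := inferInstanceAs (Category (WeakMap A B))
  whiskerLeft F _ _ σ := WeakMap.whiskerLeft F σ
  whiskerRight σ H := WeakMap.whiskerRight σ H
  associator F G H := WeakMap.associator F G H
  leftUnitor F := WeakMap.leftUnitor F
  rightUnitor F := WeakMap.rightUnitor F
  whiskerLeft_id _ _ := Transformation.ext (Functor.whiskerLeft_id _)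
  whiskerLeft_comp _ _ _ _ _ _ := Transformation.ext (Functor.whiskerLeft_comp _ _ _)
  id_whiskerLeft σ := Transformation.ext (NatTrans.ext (funext fun x =>
    ((Category.id_comp _).trans (Category.comp_id (σ.natTrans.app x))).symm))
  comp_whiskerLeft F G _ _ σ := Transformation.ext (NatTrans.ext (funext fun x =>
    ((Category.id_comp _).trans
      (Category.comp_id (σ.natTrans.app (G.functor.obj (F.functor.obj x))))).symm))
  id_whiskerRight _ H := Transformation.ext (NatTrans.ext (funext fun _ => H.functor.map_id _))
  comp_whiskerRight σ τ H := Transformation.ext (NatTrans.ext (funext fun x =>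
    H.functor.map_comp (σ.natTrans.app x) (τ.natTrans.app x)))
  whiskerRight_id σ := Transformation.ext (NatTrans.ext (funext fun x =>
    ((Category.id_comp _).trans (Category.comp_id (σ.natTrans.app x))).symm))
  whiskerRight_comp σ G H := Transformation.ext (NatTrans.ext (funext fun x =>
    ((Category.id_comp _).trans
      (Category.comp_id (H.functor.map (G.functor.map (σ.natTrans.app x))))).symm))
  whisker_assoc F _ _ σ H := Transformation.ext (NatTrans.ext (funext fun x =>
    ((Category.id_comp _).trans
      (Category.comp_id (H.functor.map (σ.natTrans.app (F.functor.obj x))))).symm))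
  whisker_exchange σ τ := Transformation.ext (NatTrans.ext (funext fun x =>
    (τ.natTrans.naturality (σ.natTrans.app x)).symm))
  pentagon _ _ _ K := Transformation.ext (NatTrans.ext (funext fun _ =>
    (congrArg (· ≫ 𝟙 _ ≫ 𝟙 _) (K.functor.map_id _)).trans (Category.id_comp _)))
  triangle _ G := Transformation.ext (NatTrans.ext (funext fun _ =>
    (Category.id_comp _).trans (G.functor.map_id _).symm))

theorem WeakMap.eq_of_coh {A B : Algebra.{w, v', v, u} Q} {F G : WeakMap A B}
    (h : F.functor = G.functor)
    (hc : ∀ {n : ℕ} (q : Q.Op n) (a : Fin n → A.carrier), HEq (F.coh q a) (G.coh q a)) :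
    F = G := by
  obtain ⟨F, c, _, _, _⟩ := F
  obtain ⟨G, d, _, _, _⟩ := G
  obtain rfl : F = G := h
  obtain rfl : @c = @d := by
    funext n q a
    exact eq_of_heq (hc q a)
  rfl

theorem eqToHom_app {A B : Algebra.{w, v', v, u} Q} {F G : WeakMap A B} (h : F = G)
    (x : A.carrier) :
    (Transformation.natTrans (eqToHom h)).app x =
      eqToHom (congrArg (fun F : WeakMap A B => F.functor.obj x) h) := by
  subst h
  rfl

theorem WeakMap.id_comp {A B : Algebra.{w, v', v, u} Q} (F : WeakMap A B) :
    (WeakMap.id A).comp F = F :=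
  WeakMap.eq_of_coh rfl fun q a => heq_of_eq (Iso.ext
    ((congrArg _ (F.functor.map_id _)).trans (Category.comp_id (F.coh q a).hom)))

theorem WeakMap.comp_id {A B : Algebra.{w, v', v, u} Q} (F : WeakMap A B) :
    F.comp (WeakMap.id B) = F :=
  WeakMap.eq_of_coh rfl fun q a => heq_of_eq (Iso.ext (Category.id_comp (F.coh q a).hom))

theorem WeakMap.assoc {A B C D : Algebra.{w, v', v, u} Q} (F : WeakMap A B) (G : WeakMap B C)
    (H : WeakMap C D) : (F.comp G).comp H = F.comp (G.comp H) :=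
  WeakMap.eq_of_coh rfl fun _ _ => heq_of_eq (Iso.ext
    ((congrArg _ (H.functor.map_comp _ _)).trans (Category.assoc _ _ _).symm))

/-- Composition of weak maps is strictly associative and unital, so that this bicategory is
indeed a 2-category. -/
instance : Bicategory.Strict (Algebra.{w, v', v, u} Q) where
  id_comp F := WeakMap.id_comp F
  comp_id F := WeakMap.comp_id F
  assoc F G H := WeakMap.assoc F G H
  leftUnitor_eqToIso F := Iso.ext (Transformation.ext (NatTrans.ext (funext fun x =>
    (eqToHom_app (WeakMap.id_comp F) x).symm)))
  rightUnitor_eqToIso F := Iso.ext (Transformation.ext (NatTrans.ext (funext fun x =>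
    (eqToHom_app (WeakMap.comp_id F) x).symm)))
  associator_eqToIso F G H := Iso.ext (Transformation.ext (NatTrans.ext (funext fun x =>
    (eqToHom_app (WeakMap.assoc F G H) x).symm)))

/-- A map of `Cat`-operads. -/
structure Map (Q : CatOperad.{w, v'}) (R : CatOperad.{w, v'}) where
  functor (n : ℕ) : Q.Op n ⥤ R.Op n
  map_one : (functor 1).obj Q.one = R.one
  map_comp_obj {n : ℕ} {k : Fin n → ℕ} (p : Q.Op n) (q : ∀ i, Q.Op (k i)) :
    (functor _).obj ((Q.comp k).obj (p, q)) =
      (R.comp k).obj ((functor n).obj p, fun i => (functor (k i)).obj (q i))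
  map_comp_map {n : ℕ} {k : Fin n → ℕ} {p p' : Q.Op n} {q q' : ∀ i, Q.Op (k i)} (f : p ⟶ p')
    (g : ∀ i, q i ⟶ q' i) :
    (functor _).map ((Q.comp k).map (Prod.mkHom (Y₁ := q) (Y₂ := q') f g)) =
      eqToHom (map_comp_obj p q) ≫
        (R.comp k).map (Prod.mkHom (Y₁ := fun i => (functor (k i)).obj (q i))
          (Y₂ := fun i => (functor (k i)).obj (q' i)) ((functor n).map f)
          fun i => (functor (k i)).map (g i)) ≫
        eqToHom (map_comp_obj p' q').symm

/-- The functor `Qₙ × Aⁿ ⥤ Rₙ × Aⁿ` induced by a functor `Qₙ ⥤ Rₙ`. -/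
abbrev onOperations {C D : Type w} [Category.{v'} C] [Category.{v'} D] (F : C ⥤ D) (n : ℕ)
    (A : Type u) [Category.{v} A] : C × (Fin n → A) ⥤ D × (Fin n → A) :=
  F.prod (𝟭 (Fin n → A))

theorem act_map_eqToHom (A : Algebra.{w, v', v, u} Q) {n : ℕ} {p p' : Q.Op n} (h : p = p')
    {a b : Fin n → A.carrier} {q q' : Q.Op n} (h' : q = q') (f : p' ⟶ q) (t : ∀ i, a i ⟶ b i) :
    (A.act n).map (Prod.mkHom (Y₁ := a) (Y₂ := b) (eqToHom h ≫ f ≫ eqToHom h') t) =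
      eqToHom (by rw [h]) ≫ (A.act n).map (Prod.mkHom (Y₁ := a) (Y₂ := b) f t) ≫
        eqToHom (by rw [h']) := by
  subst h h'
  simp

/-- Restriction of an algebra along a map of `Cat`-operads. -/
def Algebra.restrict {Q R : CatOperad.{w, v'}} (A : Algebra.{w, v', v, u} R) (F : Map Q R) :
    Algebra.{w, v', v, u} Q where
  carrier := A.carrier
  action := { act := fun n => onOperations (F.functor n) n A.carrier ⋙ A.act n }
  isAlgebra :=
    { one_obj := fun a =>
        (congrArg (fun x => (A.act 1).obj (x, a)) F.map_one).trans (A.isAlgebra.one_obj a)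
      one_map := fun {a b} t => by
        have h := act_map_eqToHom A F.map_one F.map_one.symm (𝟙 R.one) t
        rw [A.isAlgebra.one_map t] at h
        refine Eq.trans (congrArg (fun x => (A.act 1).map (Prod.mkHom (Y₁ := a) (Y₂ := b) x t))
          ?_) (h.trans ?_)
        · simp
        · simp
      comp_obj := fun p q a =>
        (congrArg (fun x => (A.act _).obj (x, a)) (F.map_comp_obj p q)).trans
          (A.isAlgebra.comp_obj _ _ a)
      comp_map := fun {n k p p' q q' a b} f g t => by
        have h := act_map_eqToHom A (F.map_comp_obj p q) (F.map_comp_obj p' q').symm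
          ((R.comp k).map (Prod.mkHom (Y₁ := fun i => (F.functor (k i)).obj (q i))
            (Y₂ := fun i => (F.functor (k i)).obj (q' i)) ((F.functor n).map f)
            fun i => (F.functor (k i)).map (g i))) t
        rw [A.isAlgebra.comp_map] at h
        refine Eq.trans (congrArg (fun x => (A.act _).map (Prod.mkHom (Y₁ := a) (Y₂ := b) x t))
          (F.map_comp_map f g)) (h.trans ?_)
        simp }

end CatOperad

/-! ### Strict and weak `P`-categories -/

/-- Morphisms in a sequence of thin categories agree as soon as their end points do. -/
theorem thin_heq {X : ℕ → Type w} [∀ n, Category.{v'} (X n)] [∀ n, Quiver.IsThin (X n)] {m n : ℕ}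
    (h : m = n) {a b : X m} {c d : X n} (hac : HEq a c) (hbd : HEq b d) (f : a ⟶ b) (g : c ⟶ d) :
    HEq f g := by
  subst h
  obtain rfl := eq_of_heq hac
  obtain rfl := eq_of_heq hbd
  exact heq_of_eq (Subsingleton.elim _ _)

theorem discrete_heq {X : ℕ → Type w} {m n : ℕ} (h : m = n) {a : X m} {b : X n} (hab : HEq a b) :
    HEq (Discrete.mk a) (Discrete.mk b) := by
  subst h
  obtain rfl := eq_of_heq hab
  rfl

namespace PlainOperad

variable (P : PlainOperad.{w})

/-- The `Cat`-operad `D_* P`, with `(D_* P)ₙ` the discrete category on `Pₙ`. -/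
def disc : CatOperad.{w, w} where
  Op n := Discrete (P.Op n)
  one := ⟨P.one⟩
  comp k :=
    { obj := fun x => ⟨P.comp x.1.as fun i => (x.2 i).as⟩
      map := fun {x y} f => Discrete.eqToHom (by
        have h1 : x.1 = y.1 := Discrete.ext (Discrete.eq_of_hom f.1)
        have h2 : x.2 = y.2 := funext fun i => Discrete.ext (Discrete.eq_of_hom (f.2 i))
        rw [h1, h2]) }
  assoc_obj p q r := discrete_heq (sum_blocks _ _).symm (P.assoc _ _ _)
  assoc_map {n k l p p' q q' r r'} f g t :=
    thin_heq (X := fun n => Discrete (P.Op n)) (sum_blocks k l).symm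
      (discrete_heq (sum_blocks k l).symm
        (P.assoc p.as (fun i => (q i).as) (fun x => (r x).as)))
      (discrete_heq (sum_blocks k l).symm
        (P.assoc p'.as (fun i => (q' i).as) (fun x => (r' x).as))) _ _
  one_comp_obj q := discrete_heq (Fin.sum_univ_one _) (P.one_comp fun i => (q i).as)
  one_comp_map {k q q'} g := thin_heq (X := fun n => Discrete (P.Op n)) (Fin.sum_univ_one k)
    (discrete_heq (Fin.sum_univ_one _) (P.one_comp fun i => (q i).as))
    (discrete_heq (Fin.sum_univ_one _) (P.one_comp fun i => (q' i).as)) _ _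
  comp_one_obj p := discrete_heq (sum_ones _) (P.comp_one _)
  comp_one_map {n p p'} f := thin_heq (X := fun n => Discrete (P.Op n)) (sum_ones n)
    (discrete_heq (sum_ones n) (P.comp_one p.as))
    (discrete_heq (sum_ones n) (P.comp_one p'.as)) _ _

/-- The 1-cells of the unbiased weakening of `P`: trees labelled by the operations of `P`. -/
abbrev WkOp (n : ℕ) : Type w :=
  SRTree P.Op n

variable {P}

/-- There is a single 2-cell `s ⟶ t` if `ε(s) = ε(t)`, and no 2-cell otherwise. -/
instance (n : ℕ) : Category.{w} (P.WkOp n) where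
  Hom s t := ULift (PLift (eval s = eval t))
  id _ := ⟨⟨rfl⟩⟩
  comp f g := ⟨⟨f.down.down.trans g.down.down⟩⟩

instance (n : ℕ) : Quiver.IsThin (P.WkOp n) := fun _ _ =>
  inferInstanceAs (Subsingleton (ULift (PLift _)))

/-- The 2-cell between two trees with the same evaluation. -/
def wkIso {n : ℕ} {s t : P.WkOp n} (h : eval s = eval t) : s ≅ t where
  hom := ⟨⟨h⟩⟩
  inv := ⟨⟨h.symm⟩⟩
  hom_inv_id := Subsingleton.elim _ _
  inv_hom_id := Subsingleton.elim _ _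

variable (P)

/-- The unbiased weakening `Wk(P)` of a plain operad `P`. -/
def wk : CatOperad.{w, w} where
  Op n := P.WkOp n
  one := SRTree.leaf
  comp k :=
    { obj := fun x => SRTree.graft x.1 x.2
      map := fun {x y} f => (wkIso (by
        rw [eval_graft, eval_graft, f.1.down.down]
        exact congrArg _ (funext fun i => (f.2 i).down.down))).hom }
  assoc_obj p q r := SRTree.graft_assoc p q r
  assoc_map {n k l p p' q q' r r'} f g t := thin_heq (X := P.WkOp) (sum_blocks k l).symm
    (SRTree.graft_assoc p q r) (SRTree.graft_assoc p' q' r') _ _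
  one_comp_obj q := SRTree.leaf_graft q
  one_comp_map {k q q'} g := thin_heq (X := P.WkOp) (Fin.sum_univ_one k)
    (SRTree.leaf_graft q) (SRTree.leaf_graft q') _ _
  comp_one_obj p := SRTree.graft_leaf p
  comp_one_map {n p p'} f := thin_heq (X := P.WkOp) (sum_ones n)
    (SRTree.graft_leaf p) (SRTree.graft_leaf p') _ _

instance (n : ℕ) : Quiver.IsThin (P.wk.Op n) :=
  inferInstanceAs (Quiver.IsThin (P.WkOp n))

instance (n : ℕ) : Quiver.IsThin (P.disc.Op n) :=
  inferInstanceAs (Quiver.IsThin (Discrete (P.Op n)))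

variable {P} in
/-- The counit `ε`, as a functor. -/
def evalFunctor (n : ℕ) : P.WkOp n ⥤ Discrete (P.Op n) where
  obj t := ⟨eval t⟩
  map f := Discrete.eqToHom f.down.down
  map_id _ := Subsingleton.elim _ _
  map_comp _ _ := Subsingleton.elim _ _

/-- The map `π : Wk(P) ⟶ D_* P` extending the counit `ε`. -/
def wkToDisc : CatOperad.Map P.wk P.disc where
  functor n := evalFunctor n
  map_one := rfl
  map_comp_obj p q := congrArg Discrete.mk (eval_graft p q)
  map_comp_map {n k p p' q q'} f g := by
    have : Quiver.IsThin (P.disc.Op (∑ i, k i)) := inferInstance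
    exact (this _ _).elim _ _

/-- The map `π` is levelwise full and faithful. -/
theorem wkToDisc_full_faithful (n : ℕ) :
    (P.wkToDisc.functor n).Full ∧ (P.wkToDisc.functor n).Faithful :=
  ⟨⟨fun f => ⟨⟨⟨Discrete.eq_of_hom f⟩⟩, Subsingleton.elim _ _⟩⟩,
    ⟨fun _ => Subsingleton.elim _ _⟩⟩

/-- The embedding `ι : D_* P ⟶ Wk(P)`, `p ↦ p ∘ (|, …, |)`, a levelwise functor. -/
def iota (n : ℕ) : P.disc.Op n ⥤ P.wk.Op n :=
  Discrete.functor fun p => (corolla p : P.WkOp n)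

/-- The objects of the 2-category `Wk-P-Cat`: weak `P`-categories, that is, algebras for `Wk(P)`. -/
abbrev WeakCat : Type _ :=
  CatOperad.Algebra.{w, w, v, u} P.wk

/-- Strict `P`-categories, that is, algebras for `D_* P`. -/
abbrev StrictCat : Type _ :=
  CatOperad.Algebra.{w, w, v, u} P.disc

variable {P}

/-- A strict `P`-category, considered as a weak `P`-category. -/
abbrev StrictCat.toWeak (A : StrictCat.{w, v, u} P) : WeakCat.{w, v, u} P :=
  A.restrict P.wkToDisc

/-! ### Strictification -/

variable (A : WeakCat.{w, v, u} P)

/-- The composite `P ∘ A ⥤ Wk(P) ∘ A ⥤ A` of `ι ∘ 1` and the structure map `h`. -/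
def comparison : CatOperad.Kel P.disc.Op A.carrier ⥤ A.carrier :=
  Sigma.Functor.sigma (fun n => CatOperad.onOperations (P.iota n) n A.carrier) ⋙ A.structureMap

/-- The category `st A`: its objects are those of `P ∘ A`, and its morphisms `x ⟶ y` are the
morphisms `h(ι ∘ 1)(x) ⟶ h(ι ∘ 1)(y)` of `A`. -/
abbrev St : Type (max w u) :=
  InducedCategory A.carrier (comparison A).obj

/-- The first factor `P ∘ A ⥤ st A` of `h(ι ∘ 1)`. -/
def toSt : CatOperad.Kel P.disc.Op A.carrier ⥤ St A where
  obj x := x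
  map f := InducedCategory.homMk ((comparison A).map f)

/-- The second factor `st A ⥤ A` of `h(ι ∘ 1)`. -/
def fromSt : St A ⥤ A.carrier :=
  inducedFunctor _

/-- These functors are the factorization of `h(ι ∘ 1)` into a functor which is bijective on objects
and one which is full and faithful. -/
theorem st_factorization :
    Function.Bijective (toSt A).obj ∧ (fromSt A).Full ∧ (fromSt A).Faithful ∧
      toSt A ⋙ fromSt A = comparison A :=
  ⟨Function.bijective_id, InducedCategory.full _, InducedCategory.faithful _, rfl⟩

variable {A}

/-- The action of `P` on the objects of `st A`:
`(p, ((p₁, a₁_•), …, (pₙ, aₙ_•))) ↦ (p ∘ (p₁, …, pₙ), a_•^•)`. -/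
def stObj {n : ℕ} (p : P.disc.Op n) (x : Fin n → St A) : St A :=
  ⟨∑ i, (x i).1, ⟨P.comp p.as fun i => (x i).2.1.as⟩, concat fun i => (x i).2.2⟩

theorem conj_comp {C : Type u} [Category.{v} C] {X X' Y Y' Z Z' : C} (a : X ≅ X') (b : Y ≅ Y')
    (c : Z ≅ Z') (f : X ⟶ Y) (g : Y ⟶ Z) :
    a.inv ≫ (f ≫ g) ≫ c.hom = (a.inv ≫ f ≫ b.hom) ≫ b.inv ≫ g ≫ c.hom := by
  simp

theorem eval_graft_corolla {n : ℕ} (p : P.Op n) {k : Fin n → ℕ} (q : ∀ i, P.Op (k i)) :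
    eval ((corolla p).graft fun i => corolla (q i)) = eval (corolla (P.comp p q)) := by
  simp only [eval_graft, eval_corolla]

/-- The isomorphism `δ : h(p, h(p₁, a₁_•), …, h(pₙ, aₙ_•)) ≅ h(p ∘ (p₁, …, pₙ), a_•^•)`, the image
under `h` of the 2-cell of `Wk(P)` from the grafting of the corollas of `p₁, …, pₙ` on the corolla of
`p` to the corolla of `p ∘ (p₁, …, pₙ)`. -/
def stIso {n : ℕ} (p : P.disc.Op n) (x : Fin n → St A) :
    (A.act n).obj ((P.iota n).obj p, fun i => (fromSt A).obj (x i)) ≅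
      (fromSt A).obj (stObj p x) :=
  eqToIso (by
    refine Eq.symm ((A.isAlgebra.comp_obj ((P.iota n).obj p)
      (fun i => (P.iota (x i).1).obj (x i).2.1) (concat fun i => (x i).2.2)).trans ?_)
    simp only [block_concat]
    rfl) ≪≫
  (A.act _).mapIso (Iso.prod (wkIso (eval_graft_corolla p.as fun i => (x i).2.1.as))
    (Iso.refl (concat fun i => (x i).2.2)))

variable (A)

/-- The functor `Pₙ × (st A)ⁿ ⥤ A`, `(p, x_•) ↦ h(p, F x_•)`, where `F` is `st A ⥤ A`. -/
def stPre (n : ℕ) : P.disc.Op n × (Fin n → St A) ⥤ A.carrier :=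
  (P.iota n).prod (Functor.pi fun _ => fromSt A) ⋙ A.act n

/-- The action of `P` on `st A`.  On a family of morphisms `fᵢ : (pᵢ, aᵢ_•) ⟶ (pᵢ', aᵢ_•')` it is
the composite `δ⁻¹ ≫ h(p, f_•) ≫ δ`. -/
def stAction : P.disc.Action (St A) where
  act n :=
    { obj := fun x => stObj x.1 x.2
      map := fun {x y} f => InducedCategory.homMk
        ((stIso x.1 x.2).inv ≫ (stPre A n).map f ≫ (stIso y.1 y.2).hom)
      map_id := fun x => by
        refine InducedCategory.hom_ext ((congrArg
          (fun m => (stIso x.1 x.2).inv ≫ m ≫ (stIso x.1 x.2).hom)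
          ((stPre A n).map_id x)).trans ?_)
        exact (congrArg (fun m => (stIso x.1 x.2).inv ≫ m) (Category.id_comp _)).trans
          (Iso.inv_hom_id _)
      map_comp := fun {x y z} f g => by
        refine InducedCategory.hom_ext ((congrArg
          (fun m => (stIso x.1 x.2).inv ≫ m ≫ (stIso z.1 z.2).hom)
          ((stPre A n).map_comp f g)).trans ?_)
        exact conj_comp (stIso x.1 x.2) (stIso y.1 y.2) (stIso z.1 z.2) _ _ }

/-- The strictification of `A`, given that the action of `P` on `st A` satisfies the axioms of a
strict `P`-category. -/
def strictification (h : (stAction A).IsAlgebra) : StrictCat.{w, v, max w u} P where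
  carrier := St A
  action := stAction A
  isAlgebra := h

end PlainOperad

/-!
The functor `F : st A ⥤ A`, which sends `(p, a_•)` to `h(ι p, a_•)`, is full and faithful by
construction, and essentially surjective because `h(ι 1, a) ≅ h(|, a) = a`.  So it is enough that
`st A` is a strict `P`-category, that `F` underlies a weak `P`-functor, and that a weak functor whose
underlying functor is an equivalence is an equivalence in the 2-category of algebras.

The last point (`CatOperad.WeakMap.nonempty_equivalence`) holds for any `Cat`-operad.  A quasi-inverse
`G` of `F` acquires coherence isomorphisms by asking that their images under `F` be
`F h(q, G b_•) ≅ h(q, F G b_•) ≅ h(q, b_•) ≅ F G h(q, b_•)`; since `F` is faithful, all axioms may be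
checked after applying `F`.

The other two points rest on a coherence principle.  Call a morphism of `A` canonical
(`PlainOperad.IsCanonical`) if it is, up to equality of its end points, the image under `h` of a 2-cell
between two trees with the same objects of `A` attached to their leaves.  As there is at most one
2-cell between two trees, a canonical morphism is determined by the decorated trees at its two ends
(`IsCanonical.unique`); and canonical morphisms are closed under composition and under the action of
`Wk(P)`.  For a tree `q` with composite `p`, the isomorphism `h(q, F x_•) ≅ F (p · x_•)`
(`PlainOperad.stCoh`), which generalizes `δ`, is canonical, so its compatibility with the identity and
with composition is automatic (`stCoh_one`, `stCoh_comp`).  These isomorphisms are the coherence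
isomorphisms of the weak functor `F`.  They also give the axioms for the action on the morphisms of
`st A`, because that action is conjugate by them to the action on `A` (`fromSt_map_stMap`).
-/

namespace CatOperad

variable {Q : CatOperad.{w, v'}}

/-! ### Weak maps whose underlying functor is an equivalence -/

/-- The morphism `h(f, t₁, …, tₙ)`. -/
def Algebra.actMap (A : Algebra.{w, v', v, u} Q) {n : ℕ} {p p' : Q.Op n}
    {a b : Fin n → A.carrier} (f : p ⟶ p') (t : ∀ i, a i ⟶ b i) :
    (A.act n).obj (p, a) ⟶ (A.act n).obj (p', b) :=
  (A.act n).map (Prod.mkHom (Y₁ := a) (Y₂ := b) f t)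

theorem Algebra.actMap_id (A : Algebra.{w, v', v, u} Q) {n : ℕ} (p : Q.Op n)
    (a : Fin n → A.carrier) : A.actMap (𝟙 p) (fun i => 𝟙 (a i)) = 𝟙 _ :=
  (A.act n).map_id (p, a)

theorem Algebra.actMap_comp (A : Algebra.{w, v', v, u} Q) {n : ℕ} {p p' p'' : Q.Op n}
    {a b c : Fin n → A.carrier} (f : p ⟶ p') (g : p' ⟶ p'') (t : ∀ i, a i ⟶ b i)
    (s : ∀ i, b i ⟶ c i) :
    A.actMap f t ≫ A.actMap g s = A.actMap (f ≫ g) (fun i => t i ≫ s i) :=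
  ((A.act n).map_comp (Prod.mkHom (Y₁ := a) (Y₂ := b) f t)
    (Prod.mkHom (Y₁ := b) (Y₂ := c) g s)).symm

theorem Algebra.actMap_id_comp (A : Algebra.{w, v', v, u} Q) {n : ℕ} (p : Q.Op n)
    {a b c : Fin n → A.carrier} (t : ∀ i, a i ⟶ b i) (s : ∀ i, b i ⟶ c i) :
    A.actMap (𝟙 p) t ≫ A.actMap (𝟙 p) s = A.actMap (𝟙 p) (fun i => t i ≫ s i) := by
  rw [actMap_comp, Category.id_comp]

/-- The isomorphism `h(p, t₁, …, tₙ)`. -/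
def Algebra.actIso (A : Algebra.{w, v', v, u} Q) {n : ℕ} (p : Q.Op n)
    {a b : Fin n → A.carrier} (t : ∀ i, a i ≅ b i) :
    (A.act n).obj (p, a) ≅ (A.act n).obj (p, b) where
  hom := A.actMap (𝟙 p) fun i => (t i).hom
  inv := A.actMap (𝟙 p) fun i => (t i).inv
  hom_inv_id := by
    rw [actMap_id_comp]
    simp only [Iso.hom_inv_id]
    exact A.actMap_id p a
  inv_hom_id := by
    rw [actMap_id_comp]
    simp only [Iso.inv_hom_id]
    exact A.actMap_id p b

theorem Algebra.actMap_one (A : Algebra.{w, v', v, u} Q) {a b : Fin 1 → A.carrier}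
    (t : ∀ i, a i ⟶ b i) :
    A.actMap (𝟙 Q.one) t =
      eqToHom (A.isAlgebra.one_obj a) ≫ t 0 ≫ eqToHom (A.isAlgebra.one_obj b).symm :=
  A.isAlgebra.one_map t

theorem Algebra.actMap_block (A : Algebra.{w, v', v, u} Q) {n : ℕ} {k : Fin n → ℕ} {p p' : Q.Op n}
    {q q' : ∀ i, Q.Op (k i)} {a b : Fin (∑ i, k i) → A.carrier} (f : p ⟶ p')
    (g : ∀ i, q i ⟶ q' i) (t : ∀ x, a x ⟶ b x) :
    A.actMap ((Q.comp k).map (Prod.mkHom (Y₁ := q) (Y₂ := q') f g)) t =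
      eqToHom (A.isAlgebra.comp_obj p q a) ≫
        A.actMap f (fun i => A.actMap (a := block a i) (b := block b i) (g i)
          fun j => t (finSigmaFinEquiv ⟨i, j⟩)) ≫
        eqToHom (A.isAlgebra.comp_obj p' q' b).symm :=
  A.isAlgebra.comp_map f g t

theorem Algebra.actMap_id_block (A : Algebra.{w, v', v, u} Q) {n : ℕ} {k : Fin n → ℕ} (p : Q.Op n)
    (q : ∀ i, Q.Op (k i)) {a b : Fin (∑ i, k i) → A.carrier} (t : ∀ x, a x ⟶ b x) :
    A.actMap (𝟙 ((Q.comp k).obj (p, q))) t =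
      eqToHom (A.isAlgebra.comp_obj p q a) ≫
        A.actMap (𝟙 p) (fun i => A.actMap (a := block a i) (b := block b i) (𝟙 (q i))
          fun j => t (finSigmaFinEquiv ⟨i, j⟩)) ≫
        eqToHom (A.isAlgebra.comp_obj p q b).symm := by
  rw [← actMap_block]
  exact congrArg (fun m => A.actMap m t) ((Q.comp k).map_id (p, q)).symm

namespace WeakMap

variable {A B : Algebra.{w, v', v, u} Q} (F : WeakMap A B)

theorem map_actMap {n : ℕ} {q q' : Q.Op n} {a b : Fin n → A.carrier} (f : q ⟶ q')
    (t : ∀ i, a i ⟶ b i) :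
    F.functor.map (A.actMap f t) =
      (F.coh q a).inv ≫ B.actMap f (fun i => F.functor.map (t i)) ≫ (F.coh q' b).hom := by
  rw [Iso.eq_inv_comp]
  exact (F.coh_naturality f t).symm

theorem coh_comp_hom {n : ℕ} {k : Fin n → ℕ} (p : Q.Op n) (q : ∀ i, Q.Op (k i))
    (a : Fin (∑ i, k i) → A.carrier) :
    (F.coh ((Q.comp k).obj (p, q)) a).hom =
      eqToHom (B.isAlgebra.comp_obj p q _) ≫
        B.actMap (𝟙 p) (fun i => (F.coh (q i) (block a i)).hom) ≫
        (F.coh p fun i => (A.act (k i)).obj (q i, block a i)).hom ≫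
        F.functor.map (eqToHom (A.isAlgebra.comp_obj p q a).symm) :=
  F.coh_comp p q a

section QuasiInverse

variable {G : B.carrier ⥤ A.carrier} (ε : G ⋙ F.functor ≅ 𝟭 B.carrier)

/-- The components of a natural isomorphism `F G ≅ 1`, typed without the composite functor. -/
def counitApp (b : B.carrier) : F.functor.obj (G.obj b) ≅ b :=
  ε.app b

theorem map_map_counitApp {b c : B.carrier} (f : b ⟶ c) :
    F.functor.map (G.map f) ≫ (F.counitApp ε c).hom = (F.counitApp ε b).hom ≫ f :=
  ε.hom.naturality f

theorem map_map_eq {b c : B.carrier} (f : b ⟶ c) :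
    F.functor.map (G.map f) = (F.counitApp ε b).hom ≫ f ≫ (F.counitApp ε c).inv := by
  rw [← Category.assoc, Iso.eq_comp_inv, map_map_counitApp]

theorem counitApp_inv_map_map {b c : B.carrier} (f : b ⟶ c) :
    (F.counitApp ε b).inv ≫ F.functor.map (G.map f) = f ≫ (F.counitApp ε c).inv := by
  rw [map_map_eq, Iso.inv_hom_id_assoc]

variable [F.functor.Full] [F.functor.Faithful]

/-- The coherence isomorphism of a quasi-inverse `G` of `F`: its image under `F` is
`F h(q, G b_•) ≅ h(q, F G b_•) ≅ h(q, b_•) ≅ F G h(q, b_•)`. -/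
noncomputable def quasiCoh {n : ℕ} (q : Q.Op n) (b : Fin n → B.carrier) :
    (A.act n).obj (q, fun i => G.obj (b i)) ≅ G.obj ((B.act n).obj (q, b)) :=
  F.functor.preimageIso ((F.coh q fun i => G.obj (b i)).symm ≪≫
    B.actIso q (fun i => F.counitApp ε (b i)) ≪≫ (F.counitApp ε _).symm)

theorem map_quasiCoh {n : ℕ} (q : Q.Op n) (b : Fin n → B.carrier) :
    F.functor.map (F.quasiCoh ε q b).hom =
      (F.coh q fun i => G.obj (b i)).inv ≫
        B.actMap (𝟙 q) (fun i => (F.counitApp ε (b i)).hom) ≫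
        (F.counitApp ε ((B.act n).obj (q, b))).inv :=
  F.functor.map_preimage _

theorem quasiCoh_naturality {n : ℕ} {q q' : Q.Op n} {a b : Fin n → B.carrier} (f : q ⟶ q')
    (t : ∀ i, a i ⟶ b i) :
    A.actMap f (fun i => G.map (t i)) ≫ (F.quasiCoh ε q' b).hom =
      (F.quasiCoh ε q a).hom ≫ G.map (B.actMap f t) := by
  apply F.functor.map_injective
  rw [Functor.map_comp, Functor.map_comp, map_quasiCoh, map_quasiCoh, map_actMap]
  simp only [Category.assoc, Iso.hom_inv_id_assoc, counitApp_inv_map_map]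
  congr 1
  simp only [← Category.assoc, Algebra.actMap_comp, Category.comp_id, Category.id_comp,
    map_map_counitApp]

theorem quasiCoh_one (a : Fin 1 → B.carrier) :
    (F.quasiCoh ε Q.one a).hom =
      eqToHom ((A.isAlgebra.one_obj _).trans (congrArg G.obj (B.isAlgebra.one_obj a).symm)) := by
  apply F.functor.map_injective
  have h : (F.coh Q.one fun i => G.obj (a i)).inv = eqToHom ((congrArg F.functor.obj
      (A.isAlgebra.one_obj fun i => G.obj (a i))).trans
        (B.isAlgebra.one_obj fun i => F.functor.obj (G.obj (a i))).symm) := by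
    rw [← eqToIso.inv (((B.isAlgebra.one_obj _).trans (congrArg F.functor.obj
      (A.isAlgebra.one_obj fun i => G.obj (a i)).symm))), Iso.inv_eq_inv]
    exact F.coh_one _
  -- Naturality of the counit with respect to an equality of objects.
  have h' : ∀ {b c : B.carrier} (e : b = c), (F.counitApp ε c).inv =
      eqToHom e.symm ≫ (F.counitApp ε b).inv ≫ eqToHom (by rw [e]) := by
    rintro b _ rfl
    simp
  rw [map_quasiCoh, h, Algebra.actMap_one, eqToHom_map, h' (B.isAlgebra.one_obj a).symm]
  simp

theorem quasiCoh_comp {n : ℕ} {k : Fin n → ℕ} (p : Q.Op n) (q : ∀ i, Q.Op (k i))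
    (a : Fin (∑ i, k i) → B.carrier) :
    (F.quasiCoh ε ((Q.comp k).obj (p, q)) a).hom =
      eqToHom (A.isAlgebra.comp_obj p q _) ≫
        A.actMap (𝟙 p) (fun i => (F.quasiCoh ε (q i) (block a i)).hom) ≫
        (F.quasiCoh ε p fun i => (B.act (k i)).obj (q i, block a i)).hom ≫
        G.map (eqToHom (B.isAlgebra.comp_obj p q a).symm) := by
  apply F.functor.map_injective
  simp only [Functor.map_comp, map_quasiCoh, map_actMap, Category.assoc, Iso.hom_inv_id_assoc,
    counitApp_inv_map_map]
  rw [Iso.inv_comp_eq, coh_comp_hom]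
  simp only [Category.assoc, eqToHom_map, eqToHom_trans_assoc, eqToHom_refl, Category.id_comp,
    Iso.hom_inv_id_assoc, Algebra.actMap_id_block]
  congr 1
  simp only [← Category.assoc]
  congr 2
  simp only [Algebra.actMap_id_comp, Category.assoc, Iso.inv_hom_id, Category.comp_id]
  congr 1
  funext i
  exact (Iso.hom_inv_id_assoc (F.coh (q i) fun j => G.obj (block a i j)) _).symm

/-- A quasi-inverse of a full and faithful weak map is a weak map. -/
noncomputable def quasiInverse : WeakMap B A where
  functor := G
  coh q b := F.quasiCoh ε q b
  coh_naturality f t := F.quasiCoh_naturality ε f t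
  coh_one a := F.quasiCoh_one ε a
  coh_comp p q a := F.quasiCoh_comp ε p q a

/-- The `Q`-transformation `F G ⟶ 1`. -/
noncomputable def quasiCounit : (F.quasiInverse ε).comp F ⟶ WeakMap.id B :=
  homMk ε.hom fun {n} q a => by
    change B.actMap (𝟙 q) (fun i => (F.counitApp ε (a i)).hom) ≫ 𝟙 _ =
      ((F.coh q fun i => G.obj (a i)).hom ≫ F.functor.map (F.quasiCoh ε q a).hom) ≫
        (F.counitApp ε ((B.act n).obj (q, a))).hom
    simp [map_quasiCoh]

/-- The natural isomorphism `G F ≅ 1` whose image under `F` is `F G F ≅ F`. -/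
noncomputable def unitNatIso : F.functor ⋙ G ≅ 𝟭 A.carrier :=
  NatIso.ofComponents (fun a => F.functor.preimageIso (F.counitApp ε (F.functor.obj a)))
    fun {a b} f => by
      apply F.functor.map_injective
      simp only [Functor.map_comp, Functor.preimageIso_hom, Functor.map_preimage]
      exact F.map_map_counitApp ε (F.functor.map f)

theorem map_unitNatIso (a : A.carrier) :
    F.functor.map ((F.unitNatIso ε).hom.app a) = (F.counitApp ε (F.functor.obj a)).hom :=
  F.functor.map_preimage _

/-- The `Q`-transformation `G F ⟶ 1`. -/
noncomputable def quasiUnit : F.comp (F.quasiInverse ε) ⟶ WeakMap.id A :=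
  homMk (F.unitNatIso ε).hom fun {n} q a => by
    change A.actMap (𝟙 q) (fun i => (F.unitNatIso ε).hom.app (a i)) ≫ 𝟙 _ =
      ((F.quasiCoh ε q fun i => F.functor.obj (a i)).hom ≫ G.map (F.coh q a).hom) ≫
        (F.unitNatIso ε).hom.app ((A.act n).obj (q, a))
    apply F.functor.map_injective
    rw [Category.comp_id]
    simp only [Functor.map_comp, map_actMap, map_quasiCoh, map_unitNatIso, Category.assoc]
    exact congrArg (fun m => (F.coh q fun i => G.obj (F.functor.obj (a i))).inv ≫
        B.actMap (𝟙 q) (fun i => (F.counitApp ε (F.functor.obj (a i))).hom) ≫ m)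
      ((congrArg (fun m => (F.counitApp ε _).inv ≫ m)
        (F.map_map_counitApp ε (F.coh q a).hom)).trans (Iso.inv_hom_id_assoc _ _)).symm

end QuasiInverse

/-- A `Q`-transformation whose underlying natural transformation is invertible is invertible. -/
noncomputable def isoOfIsIso {F G : WeakMap A B} (σ : F ⟶ G) [IsIso σ.natTrans] : F ≅ G where
  hom := σ
  inv := homMk (inv σ.natTrans) fun {n} q a => by
    have h : ∀ x, σ.natTrans.app x ≫ (inv σ.natTrans).app x = 𝟙 _ := fun x => by
      rw [← NatTrans.comp_app, IsIso.hom_inv_id, NatTrans.id_app]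
    have h' : ∀ x, (inv σ.natTrans).app x ≫ σ.natTrans.app x = 𝟙 _ := fun x => by
      rw [← NatTrans.comp_app, IsIso.inv_hom_id, NatTrans.id_app]
    change B.actMap (𝟙 q) (fun i => (inv σ.natTrans).app (a i)) ≫ (F.coh q a).hom = _
    have hσ : B.actMap (𝟙 q) (fun i => σ.natTrans.app (a i)) ≫ (G.coh q a).hom =
      (F.coh q a).hom ≫ σ.natTrans.app ((A.act n).obj (q, a)) := σ.comm q a
    have := congrArg (fun m => B.actMap (𝟙 q) (fun i => (inv σ.natTrans).app (a i)) ≫ m ≫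
      (inv σ.natTrans).app ((A.act n).obj (q, a))) hσ
    simp only [Category.assoc, h, Category.comp_id] at this
    rw [← this, ← Category.assoc, Algebra.actMap_id_comp]
    simp only [h', Algebra.actMap_id]
    exact Category.id_comp _
  hom_inv_id := Transformation.ext (IsIso.hom_inv_id σ.natTrans)
  inv_hom_id := Transformation.ext (IsIso.inv_hom_id σ.natTrans)

/-- A weak map whose underlying functor is an equivalence has a quasi-inverse in the 2-category of
`Q`-algebras. -/
theorem nonempty_equivalence (F : WeakMap A B) [F.functor.IsEquivalence] :
    Nonempty (Bicategory.Equivalence B A) := by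
  let ε := F.functor.asEquivalence.counitIso
  have : IsIso (Transformation.natTrans (F.quasiCounit ε)) := inferInstanceAs (IsIso ε.hom)
  have : IsIso (Transformation.natTrans (F.quasiUnit ε)) :=
    inferInstanceAs (IsIso (F.unitNatIso ε).hom)
  exact ⟨Bicategory.Equivalence.mkOfAdjointifyCounit (f := F.quasiInverse ε) (g := F)
    (isoOfIsIso (F.quasiCounit ε)).symm (isoOfIsIso (F.quasiUnit ε))⟩

end WeakMap
end CatOperad

/-! ### Operations with a sequence of arguments -/

theorem concat_block {X : Type*} {n : ℕ} {k : Fin n → ℕ} (a : Fin (∑ i, k i) → X) :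
    concat (fun i => block a i) = a := by
  funext x
  exact congrArg a (finSigmaFinEquiv.apply_symm_apply x)

theorem concat_apply {X : Type*} {n : ℕ} {k : Fin n → ℕ} (a : ∀ i, Fin (k i) → X) (i : Fin n)
    (j : Fin (k i)) : concat a (finSigmaFinEquiv ⟨i, j⟩) = a i j :=
  congrFun (block_concat a i) j

theorem sigma_op_ext {O : ℕ → Type*} {X : Type*} {m n : ℕ} (h : m = n) {p : O m} {q : O n}
    (hpq : HEq p q) {a : Fin m → X} {b : Fin n → X} (hab : ∀ x, a x = b (Fin.cast h x)) :
    (⟨m, p, a⟩ : Σ n, O n × (Fin n → X)) = ⟨n, q, b⟩ := by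
  subst h
  obtain rfl := eq_of_heq hpq
  obtain rfl : a = b := funext hab
  rfl

/-- Associativity of the substitution of operations with arguments.  The operations `p` and `q` stand
for the two sides of the associativity axiom of an operad; this covers both trees and operations of
`P`. -/
theorem sigma_concat_assoc {O : ℕ → Type*} {X : Type*} {n : ℕ} {k : Fin n → ℕ}
    {l : Fin (∑ i, k i) → ℕ} {p : O (∑ x, l x)}
    {q : O (∑ i, ∑ j, l (finSigmaFinEquiv ⟨i, j⟩))} (hpq : HEq p q) (a : ∀ x, Fin (l x) → X) :
    (⟨_, p, concat a⟩ : Σ n, O n × (Fin n → X)) =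
      ⟨_, q, concat fun i => concat fun j => a (finSigmaFinEquiv ⟨i, j⟩)⟩ := by
  refine (sigma_op_ext (sum_blocks k l) hpq.symm fun x => ?_).symm
  obtain ⟨⟨i, y⟩, rfl⟩ := finSigmaFinEquiv.surjective x
  obtain ⟨⟨j, m⟩, rfl⟩ := finSigmaFinEquiv.surjective y
  rw [finSigmaFinEquiv_assoc, concat_apply, concat_apply, concat_apply]

/-- The unit law of substitution of operations with arguments. -/
theorem sigma_concat_one {O : ℕ → Type*} {X : Type*} {k : Fin 1 → ℕ} {p : O (∑ i, k i)}
    {q : O (k 0)} (hpq : HEq p q) (a : ∀ i, Fin (k i) → X) :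
    (⟨_, p, concat a⟩ : Σ n, O n × (Fin n → X)) = ⟨_, q, a 0⟩ := by
  refine sigma_op_ext (Fin.sum_univ_one k) hpq fun x => ?_
  obtain ⟨⟨i, y⟩, rfl⟩ := finSigmaFinEquiv.surjective x
  obtain rfl := Subsingleton.elim i 0
  rw [concat_apply]
  congr 1
  apply Fin.ext
  rw [Fin.val_cast, finSigmaFinEquiv_val]
  simp

namespace PlainOperad

variable {P : PlainOperad.{w}}

theorem stObj_one {A : WeakCat.{w, v, u} P} (x : Fin 1 → St A) : stObj P.disc.one x = x 0 :=
  sigma_concat_one (O := fun n => Discrete (P.Op n))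
    (discrete_heq (Fin.sum_univ_one _) (P.one_comp fun i => (x i).2.1.as)) fun i => (x i).2.2

theorem stObj_comp {A : WeakCat.{w, v, u} P} {n : ℕ} {k : Fin n → ℕ} (p : P.disc.Op n)
    (q : ∀ i, P.disc.Op (k i)) (x : Fin (∑ i, k i) → St A) :
    stObj ((P.disc.comp k).obj (p, q)) x = stObj p fun i => stObj (q i) (block x i) :=
  sigma_concat_assoc (O := fun n => Discrete (P.Op n))
    (discrete_heq (sum_blocks _ _).symm
      (P.assoc p.as (fun i => (q i).as) fun i => (x i).2.1.as)) fun i => (x i).2.2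

/-- The operation of `P` obtained by composing the labels of a tree. -/
def wkEval {n : ℕ} (t : P.wk.Op n) : P.Op n :=
  eval t

/-- The 2-cell of `Wk(P)` between two trees with the same composite. -/
def wkCell {n : ℕ} {s t : P.wk.Op n} (h : wkEval s = wkEval t) : s ⟶ t :=
  ⟨⟨h⟩⟩

theorem wkEval_iota {n : ℕ} (p : P.disc.Op n) : wkEval ((P.iota n).obj p) = p.as :=
  eval_corolla p.as

theorem wkEval_comp {n : ℕ} {k : Fin n → ℕ} (p : P.wk.Op n) (q : ∀ i, P.wk.Op (k i)) :
    wkEval ((P.wk.comp k).obj (p, q)) = P.comp (wkEval p) fun i => wkEval (q i) :=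
  eval_graft p q

/-! ### Canonical morphisms of a weak `P`-category -/

/-- A tree labelled by operations of `P`, with objects of `A` attached to its leaves. -/
abbrev Decorated (A : WeakCat.{w, v, u} P) :=
  Σ n, P.wk.Op n × (Fin n → A.carrier)

namespace Decorated

variable {A : WeakCat.{w, v, u} P}

/-- The value in `A` of a tree with decorated leaves. -/
def val (X : Decorated A) : A.carrier :=
  (A.act X.1).obj X.2

/-- Grafting of decorated trees on a tree. -/
def graft {n : ℕ} (p : P.wk.Op n) (X : Fin n → Decorated A) : Decorated A :=
  ⟨_, (P.wk.comp _).obj (p, fun i => (X i).2.1), concat fun i => (X i).2.2⟩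

theorem graft_graft {n : ℕ} {k : Fin n → ℕ} (p : P.wk.Op n) (q : ∀ i, P.wk.Op (k i))
    (X : Fin (∑ i, k i) → Decorated A) :
    graft ((P.wk.comp k).obj (p, q)) X = graft p fun i => graft (q i) (block X i) :=
  sigma_concat_assoc (P.wk.assoc_obj p q fun i => (X i).2.1) fun i => (X i).2.2

theorem graft_one (X : Fin 1 → Decorated A) : graft P.wk.one X = X 0 :=
  sigma_concat_one (P.wk.one_comp_obj fun i => (X i).2.1) fun i => (X i).2.2

theorem val_graft {n : ℕ} (p : P.wk.Op n) (X : Fin n → Decorated A) :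
    (graft p X).val = (A.act n).obj (p, fun i => (X i).val) := by
  refine (A.isAlgebra.comp_obj p (fun i => (X i).2.1) (concat fun i => (X i).2.2)).trans ?_
  simp only [block_concat]
  rfl

end Decorated

/-- A morphism of `A` is canonical from `X` to `Y` if it is, up to the identification of its end
points with the values of the decorated trees `X` and `Y`, the image under the action of a 2-cell
of `Wk(P)`. -/
inductive IsCanonical {A : WeakCat.{w, v, u} P} (X Y : Decorated A) {x y : A.carrier}
    (f : x ⟶ y) : Prop
  | intro {n : ℕ} {s t : P.wk.Op n} (a : Fin n → A.carrier) (g : s ⟶ t) (hX : X = ⟨n, s, a⟩)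
    (hY : Y = ⟨n, t, a⟩) (hx : x = (A.act n).obj (s, a)) (hy : y = (A.act n).obj (t, a))
    (hf : f = eqToHom hx ≫ A.actMap g (fun i => 𝟙 (a i)) ≫ eqToHom hy.symm)

namespace IsCanonical

variable {A : WeakCat.{w, v, u} P} {X Y Z : Decorated A} {x y z : A.carrier}

theorem of_hom {n : ℕ} {s t : P.wk.Op n} (g : s ⟶ t) (a : Fin n → A.carrier) :
    IsCanonical ⟨n, s, a⟩ ⟨n, t, a⟩ (A.actMap g fun i => 𝟙 (a i)) :=
  ⟨a, g, rfl, rfl, rfl, rfl, by simp⟩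

theorem refl (h : X.val = x) (h' : x = y) : IsCanonical X X (eqToHom h') := by
  subst h h'
  obtain ⟨n, s, a⟩ := X
  refine ⟨a, 𝟙 s, rfl, rfl, rfl, rfl, ?_⟩
  rw [A.actMap_id]
  simp [Decorated.val]

theorem congr {X' Y' : Decorated A} (hX : X = X') (hY : Y = Y') {f : x ⟶ y}
    (hf : IsCanonical X Y f) : IsCanonical X' Y' f := by
  subst hX hY
  exact hf

/-- Coherence: a canonical morphism is determined by the decorated trees at its ends. -/
theorem unique {f g : x ⟶ y} (hf : IsCanonical X Y f) (hg : IsCanonical X Y g) : f = g := by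
  obtain ⟨a, f, rfl, rfl, rfl, rfl, rfl⟩ := hf
  obtain ⟨b, g, hX, hY, hx, hy, rfl⟩ := hg
  cases hX
  cases hY
  rw [Subsingleton.elim f g]

theorem trans {f : x ⟶ y} {g : y ⟶ z} (hf : IsCanonical X Y f) (hg : IsCanonical Y Z g) :
    IsCanonical X Z (f ≫ g) := by
  obtain ⟨a, f, rfl, rfl, rfl, rfl, rfl⟩ := hf
  obtain ⟨b, g, hY, rfl, hy, rfl, rfl⟩ := hg
  cases hY
  refine ⟨a, f ≫ g, rfl, rfl, rfl, rfl, ?_⟩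
  simp [A.actMap_comp]

/-- Canonical morphisms are closed under the action of `Wk(P)`. -/
theorem actMap {n : ℕ} {p p' : P.wk.Op n} (g : p ⟶ p') {X Y : Fin n → Decorated A}
    {x y : Fin n → A.carrier} {f : ∀ i, x i ⟶ y i} (hf : ∀ i, IsCanonical (X i) (Y i) (f i)) :
    IsCanonical (Decorated.graft p X) (Decorated.graft p' Y) (A.actMap g f) := by
  have h : ∀ i, ∃ (n : ℕ) (s t : P.wk.Op n) (a : Fin n → A.carrier) (g : s ⟶ t)
      (hx : x i = (A.act n).obj (s, a)) (hy : y i = (A.act n).obj (t, a)), X i = ⟨n, s, a⟩ ∧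
      Y i = ⟨n, t, a⟩ ∧ f i = eqToHom hx ≫ A.actMap g (fun i => 𝟙 (a i)) ≫ eqToHom hy.symm := by
    intro i
    obtain ⟨a, g, hX, hY, hx, hy, h⟩ := hf i
    exact ⟨_, _, _, a, g, hx, hy, hX, hY, h⟩
  choose k s t a u hx hy hX hY h using h
  obtain rfl : X = _ := funext hX
  obtain rfl : Y = _ := funext hY
  obtain rfl : x = _ := funext hx
  obtain rfl : y = _ := funext hy
  obtain rfl : f = _ := funext h
  -- The axiom for composites is stated for the blocks of one sequence, so the attached objects are
  -- joined into a single sequence `b`.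
  obtain ⟨b, rfl⟩ : ∃ b : Fin (∑ i, k i) → A.carrier, a = fun i => block b i :=
    ⟨concat a, funext fun i => (block_concat a i).symm⟩
  simp only [eqToHom_refl, Category.id_comp, Category.comp_id]
  simp only [Decorated.graft, concat_block]
  refine ⟨b, (P.wk.comp k).map (Prod.mkHom (Y₁ := s) (Y₂ := t) g u), rfl, rfl,
    (A.isAlgebra.comp_obj p s b).symm, (A.isAlgebra.comp_obj p' t b).symm, ?_⟩
  rw [A.actMap_block]
  simp

end IsCanonical
/-! ### The strictification -/

variable {A : WeakCat.{w, v, u} P}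

/-- An object `(p, a_•)` of `st A` as a decorated corolla. -/
def St.decorated (x : St A) : Decorated A :=
  ⟨x.1, (P.iota x.1).obj x.2.1, x.2.2⟩

theorem isCanonical_stIso {n : ℕ} (p : P.disc.Op n) (x : Fin n → St A) :
    IsCanonical (Decorated.graft ((P.iota n).obj p) fun i => St.decorated (x i))
      (St.decorated (stObj p x)) (stIso p x).hom := by
  -- The equality of objects in the definition of `stIso` is left as a variable `e`.
  have key (e) : IsCanonical (Decorated.graft ((P.iota n).obj p) fun i => St.decorated (x i))
      (St.decorated (stObj p x))
      (eqToHom e ≫ A.actMap (wkIso (eval_graft_corolla p.as fun i => (x i).2.1.as)).hom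
        fun i => 𝟙 (concat (fun i => (x i).2.2) i)) :=
    IsCanonical.trans (IsCanonical.refl (Decorated.val_graft _ _) _) (IsCanonical.of_hom _ _)
  exact key (Decorated.val_graft ((P.iota n).obj p) fun i => St.decorated (x i)).symm

/-- The isomorphism `h(s, a_•) ≅ h(t, a_•)` for trees `s` and `t` with the same composite. -/
def treeIso {n : ℕ} {s t : P.wk.Op n} (h : wkEval s = wkEval t) (a : Fin n → A.carrier) :
    (A.act n).obj (s, a) ≅ (A.act n).obj (t, a) where
  hom := A.actMap (wkCell h) fun i => 𝟙 (a i)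
  inv := A.actMap (wkCell h.symm) fun i => 𝟙 (a i)
  hom_inv_id := by
    rw [A.actMap_comp, Subsingleton.elim (_ ≫ _) (𝟙 s)]
    simp only [Category.comp_id]
    exact A.actMap_id s a
  inv_hom_id := by
    rw [A.actMap_comp, Subsingleton.elim (_ ≫ _) (𝟙 t)]
    simp only [Category.comp_id]
    exact A.actMap_id t a

/-- The isomorphism `h(q, F x_•) ≅ F (p · x_•)`, where `F` is the functor `st A ⥤ A`, for a tree `q`
with composite `p`.  For `q` the corolla of `p` this is the isomorphism `δ`. -/
def stCoh {n : ℕ} {q : P.wk.Op n} {p : P.disc.Op n} (h : wkEval q = p.as) (x : Fin n → St A) :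
    (A.act n).obj (q, fun i => (fromSt A).obj (x i)) ≅ (fromSt A).obj (stObj p x) :=
  treeIso (t := (P.iota n).obj p) (h.trans (wkEval_iota p).symm) _ ≪≫ stIso p x

theorem isCanonical_stCoh {n : ℕ} {q : P.wk.Op n} {p : P.disc.Op n} (h : wkEval q = p.as)
    (x : Fin n → St A) :
    IsCanonical (Decorated.graft q fun i => St.decorated (x i)) (St.decorated (stObj p x))
      (stCoh h x).hom := by
  refine IsCanonical.trans (IsCanonical.actMap _ fun i => ?_) (isCanonical_stIso p x)
  exact IsCanonical.refl rfl rfl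

/-- The action of `P` on the morphisms of `st A`. -/
def stMap {n : ℕ} {p p' : P.disc.Op n} {x y : Fin n → St A} (f : p ⟶ p') (t : ∀ i, x i ⟶ y i) :
    stObj p x ⟶ stObj p' y :=
  ((stAction A).act n).map (Prod.mkHom (Y₁ := x) (Y₂ := y) f t)

/-- The action on morphisms may be computed with any trees in place of the corollas in its
definition.  The unit law is then checked on the trivial tree, and the law for composites on grafted
corollas, where the axioms of `A` apply. -/
theorem fromSt_map_stMap {n : ℕ} {q q' : P.wk.Op n} {p p' : P.disc.Op n} (h : wkEval q = p.as)
    (h' : wkEval q' = p'.as) {x y : Fin n → St A} (f : p ⟶ p') (g : q ⟶ q') (t : ∀ i, x i ⟶ y i) :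
    (fromSt A).map (stMap f t) =
      (stCoh h x).inv ≫ A.actMap g (fun i => (fromSt A).map (t i)) ≫ (stCoh h' y).hom := by
  change (stIso p x).inv ≫ A.actMap ((P.iota n).map f) (fun i => (fromSt A).map (t i)) ≫
    (stIso p' y).hom = ((stIso p x).inv ≫ A.actMap _ _) ≫ _ ≫ A.actMap _ _ ≫ (stIso p' y).hom
  rw [Category.assoc]
  congr 1
  simp only [← Category.assoc]
  congr 1
  simp only [A.actMap_comp, Category.comp_id, Category.id_comp]
  congr 1

theorem wkEval_one : wkEval P.wk.one = P.disc.one.as :=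
  rfl

theorem stCoh_one (x : Fin 1 → St A) :
    (stCoh (q := P.wk.one) (p := P.disc.one) wkEval_one x).hom =
      eqToHom ((A.isAlgebra.one_obj _).trans (congrArg (fromSt A).obj (stObj_one x).symm)) := by
  refine (isCanonical_stCoh (q := P.wk.one) (p := P.disc.one) wkEval_one x).unique
    (IsCanonical.congr (Decorated.graft_one _).symm (congrArg St.decorated (stObj_one x).symm)
      (IsCanonical.refl (A.isAlgebra.one_obj fun i => (fromSt A).obj (x i)).symm _))

/-- The operation `p'` is only required to act on `x` as the composite of `p` and the `s i` does: for
trees it is the composite of the grafted tree, which is not syntactically a composite in `P`. -/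
theorem stCoh_comp {n : ℕ} {k : Fin n → ℕ} {q : P.wk.Op n} {p : P.disc.Op n} (h : wkEval q = p.as)
    {r : ∀ i, P.wk.Op (k i)} {s : ∀ i, P.disc.Op (k i)} (h' : ∀ i, wkEval (r i) = (s i).as)
    {p' : P.disc.Op (∑ i, k i)} (h'' : wkEval ((P.wk.comp k).obj (q, r)) = p'.as)
    (x : Fin (∑ i, k i) → St A) (e : stObj p' x = stObj p fun i => stObj (s i) (block x i)) :
    (stCoh h'' x).hom =
      eqToHom (A.isAlgebra.comp_obj q r fun i => (fromSt A).obj (x i)) ≫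
        A.actMap (𝟙 q) (fun i => (stCoh (h' i) (block x i)).hom) ≫
        (stCoh h fun i => stObj (s i) (block x i)).hom ≫
        (fromSt A).map (eqToHom e.symm) := by
  refine (isCanonical_stCoh h'' x).unique ?_
  rw [eqToHom_map]
  refine IsCanonical.trans (IsCanonical.congr rfl (Decorated.graft_graft q r _)
    (IsCanonical.refl (Decorated.val_graft _ _) _)) (IsCanonical.trans
    (IsCanonical.actMap _ fun i => isCanonical_stCoh (h' i) (block x i)) (IsCanonical.trans
    (isCanonical_stCoh h _) (IsCanonical.congr rfl
      (congrArg St.decorated e.symm) (IsCanonical.refl rfl _))))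

theorem stMap_one {x y : Fin 1 → St A} (t : ∀ i, x i ⟶ y i) :
    stMap (𝟙 P.disc.one) t = eqToHom (stObj_one x) ≫ t 0 ≫ eqToHom (stObj_one y).symm := by
  have : (fromSt A).Faithful := (st_factorization A).2.2.1
  apply (fromSt A).map_injective
  rw [fromSt_map_stMap wkEval_one wkEval_one (𝟙 _) (𝟙 _) t, A.actMap_one, Iso.inv_comp_eq,
    stCoh_one, stCoh_one]
  simp [eqToHom_map]

theorem stMap_comp {n : ℕ} {k : Fin n → ℕ} {p p' : P.disc.Op n} {q q' : ∀ i, P.disc.Op (k i)}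
    {x y : Fin (∑ i, k i) → St A} (f : p ⟶ p') (g : ∀ i, q i ⟶ q' i) (t : ∀ i, x i ⟶ y i) :
    stMap ((P.disc.comp k).map (Prod.mkHom (Y₁ := q) (Y₂ := q') f g)) t =
      eqToHom (stObj_comp p q x) ≫
        stMap f (fun i => stMap (x := block x i) (y := block y i) (g i)
          fun j => t (finSigmaFinEquiv ⟨i, j⟩)) ≫
        eqToHom (stObj_comp p' q' y).symm := by
  have hc : ∀ (p : P.disc.Op n) (q : ∀ i, P.disc.Op (k i)),
      wkEval ((P.wk.comp k).obj ((P.iota n).obj p, fun i => (P.iota (k i)).obj (q i))) =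
        ((P.disc.comp k).obj (p, q)).as := fun p q => by
    rw [wkEval_comp]
    simp only [wkEval_iota]
    rfl
  have : (fromSt A).Faithful := (st_factorization A).2.2.1
  apply (fromSt A).map_injective
  rw [fromSt_map_stMap (hc p q) (hc p' q') _ ((P.wk.comp k).map
    (Prod.mkHom (Y₁ := fun i => (P.iota (k i)).obj (q i))
      (Y₂ := fun i => (P.iota (k i)).obj (q' i)) ((P.iota n).map f)
      fun i => (P.iota (k i)).map (g i))) t,
    A.actMap_block, Iso.inv_comp_eq,
    stCoh_comp (wkEval_iota p) (fun i => wkEval_iota (q i)) (hc p q) x (stObj_comp p q x),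
    stCoh_comp (wkEval_iota p') (fun i => wkEval_iota (q' i)) (hc p' q') y
      (stObj_comp p' q' y)]
  simp only [Functor.map_comp, eqToHom_map, Category.assoc, eqToHom_trans_assoc, eqToHom_refl,
    Category.id_comp,
    fromSt_map_stMap (wkEval_iota p) (wkEval_iota p') f ((P.iota n).map f), Iso.hom_inv_id_assoc]
  congr 1
  simp only [← Category.assoc]
  congr 2
  simp only [A.actMap_comp, Category.comp_id, Category.id_comp]
  congr 1
  funext i
  rw [fromSt_map_stMap (wkEval_iota (q i)) (wkEval_iota (q' i)) (g i) ((P.iota (k i)).map (g i)),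
    Iso.hom_inv_id_assoc]

/-- The action of `P` on `st A` satisfies the axioms of a strict `P`-category. -/
theorem stAction_isAlgebra (A : WeakCat.{w, v, u} P) : (stAction A).IsAlgebra where
  one_obj := stObj_one
  one_map := stMap_one
  comp_obj := stObj_comp
  comp_map := stMap_comp

/-- The functor `st A ⥤ A`, as a weak `P`-functor. -/
def fromStWeakMap (A : WeakCat.{w, v, max w u} P) :
    CatOperad.WeakMap (strictification A (stAction_isAlgebra A)).toWeak A where
  functor := fromSt A
  coh q x := stCoh (p := (P.wkToDisc.functor _).obj q) rfl x
  coh_naturality {n q q' x y} f t := by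
    have h := fromSt_map_stMap (p := (P.wkToDisc.functor _).obj q)
      (p' := (P.wkToDisc.functor _).obj q') rfl rfl ((P.wkToDisc.functor _).map f) f t
    exact ((Iso.eq_inv_comp _).1 h).symm
  coh_one x := stCoh_one x
  coh_comp {n k} q r x :=
    stCoh_comp (p := (P.wkToDisc.functor _).obj q) (s := fun i => (P.wkToDisc.functor _).obj (r i))
      (p' := (P.wkToDisc.functor _).obj ((P.wk.comp k).obj (q, r))) rfl (fun _ => rfl) rfl x
      ((strictification A (stAction_isAlgebra A)).toWeak.isAlgebra.comp_obj q r x)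

theorem fromSt_isEquivalence (A : WeakCat.{w, v, u} P) : (fromSt A).IsEquivalence where
  full := (st_factorization A).2.1
  faithful := (st_factorization A).2.2.1
  -- The object `a` is the value of the trivial tree, hence isomorphic to that of `(1, a)`.
  essSurj := ⟨fun a => ⟨⟨1, P.disc.one, fun _ => a⟩,
    ⟨treeIso (t := P.wk.one) (wkEval_iota _) _ ≪≫
      eqToIso (A.isAlgebra.one_obj fun _ => a)⟩⟩⟩

end PlainOperad

theorem mainTheorem1 (P : PlainOperad.{w}) (A : PlainOperad.WeakCat.{w, v, max w u} P) :
    (Function.Bijective (PlainOperad.toSt A).obj ∧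
      (PlainOperad.fromSt A).Full ∧ (PlainOperad.fromSt A).Faithful ∧
      PlainOperad.toSt A ⋙ PlainOperad.fromSt A = PlainOperad.comparison A) ∧
    ∃ h : (PlainOperad.stAction A).IsAlgebra,
      Nonempty (Bicategory.Equivalence A (PlainOperad.strictification A h).toWeak) := by
  refine ⟨PlainOperad.st_factorization A, PlainOperad.stAction_isAlgebra A, ?_⟩
  have : (PlainOperad.fromStWeakMap A).functor.IsEquivalence := PlainOperad.fromSt_isEquivalence A
  exact (PlainOperad.fromStWeakMap A).nonempty_equivalence
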